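/- Let $n\ge 1$, let $\mathfrak F_n$ be the full Fock space over $\mathbb C^n$ with orthonormal basis $(e_w)$ indexed by the words $w$ in the letters $1,\dots,n$, let $L_i e_w=e_{iw}$ be the left creation operators, let $\mathfrak l_n$ be the norm-closed unital algebra generated by $L_1,\dots,L_n$ and $\mathfrak L_n$ its closure in the weak operator topology (WOT). For $\zeta\in\mathbb C^n$ put $L[\zeta]=\sum_i\zeta_iL_i$. Let $X=\begin{pmatrix}x&y\\ z^t&X'\end{pmatrix}\in U(1,n)$, i.e. $X^*JX=J$ with $J=\mathrm{diag}(-1,I_n)$. Let $U_X$ be the unitary operator on $\mathfrak F_n$ with $$U_Xe_{i_1\cdots i_k}=V_{i_1}\cdots V_{i_k}(xI-L[z])^{-1}e_\emptyset,\qquad V_i=(xI-L[z])^{-1}\Big(\sum_{j}X'_{ji}L_j-y_iI\Big),$$ and let $\Phi_X(A)=U_XAU_X^*$; this defines automorphisms of $\mathfrak l_n$ and of $\mathfrak L_n$ with $\Phi_X(L_i)=V_i$. Let $H$ be a complex Hilbert space and let $T=(T_1,\dots,T_n)\in\mathcal L(H)^n$ be a row contraction, i.e. $\sum_iT_iT_i^*\le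 1$. For $f\in\mathfrak l_n$ let $f(T)=\rho_T(f)$, where $\rho_T:\mathfrak l_n\to\mathcal L(H)$ is the unique (completely) contractive unital homomorphism with $\rho_T(L_i)=T_i$. Put $\Phi_X^{-1}(T)=\big(\rho_T(\Phi_X^{-1}(L_1)),\dots,\rho_T(\Phi_X^{-1}(L_n))\big)$. Call $T$ completely noncoisometric (c.n.c.) if no $h\neq0$ in $H$ satisfies $\sum_{|w|=k}\|T_w^*h\|^2=\|h\|^2$ for all $k\ge0$. If $T$ is c.n.c. and $f\in\mathfrak L_n$ has Fourier coefficients $\hat f_w=\langle fe_\emptyset,e_w\rangle$, let $f(T)$ be the limit in the strong operator topology of $f_r(T)=\sum_w\hat f_wr^{|w|}T_w$ as $r\to1^-$. 1. Let $\mathfrak j$ be a norm-closed two-sided ideal of $\mathfrak l_n$ such that $T$ is $\mathfrak j$-constrained, i.e. $f(T)=0$ for all $f\in\mathfrak j$. Then $\Phi_X(\mathfrak j)$ is a norm-closed two-sided ideal of $\mathfrak l_n$, $\Phi_X^{-1}(T)$ is a row contraction, and $\Phi_X^{-1}(T)$ is $\Phi_X(\mathfrak j)$-constrained. 2. Suppose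 that $T$ is c.n.c., and let $\mathfrak J$ be a WOT-closed two-sided ideal of $\mathfrak L_n$ such that $T$ is $\mathfrak J$-constrained, i.e. $f(T)=0$ for all $f\in\mathfrak J$. Then $\Phi_X(\mathfrak J)$ is a WOT-closed two-sided ideal of $\mathfrak L_n$, $\Phi_X^{-1}(T)$ is a c.n.c. row contraction, and $\Phi_X^{-1}(T)$ is $\Phi_X(\mathfrak J)$-constrained. -/

import Mathlib

open scoped ComplexConjugate

noncomputable section

namespace RowContraction

/-- The full Fock space on `n` generators, realised as `ℓ²` of the free monoid of words. -/
abbrev Fock (n : ℕ) : Type := lp (fun _ : FreeMonoid (Fin n) => ℂ) 2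

section Shift

variable {n : ℕ}

/-- The orthonormal basis vector `e_w` of the Fock space indexed by the word `w`. -/
def basisVec (w : FreeMonoid (Fin n)) : Fock n := by
  classical exact lp.single 2 w (1 : ℂ)

theorem inner_basisVec_left (w : FreeMonoid (Fin n)) (f : Fock n) :
    inner ℂ (basisVec w) f = f w := by
  classical
  simp [basisVec, lp.inner_single_left]

theorem orthonormal_basisVec : Orthonormal ℂ (basisVec (n := n)) := by
  classical
  rw [orthonormal_iff_ite]
  intro v w
  rw [inner_basisVec_left]
  simp [basisVec, lp.single_apply, Pi.single_apply]

theorem fock_ext {F : Type*} [NormedAddCommGroup F] [NormedSpace ℂ F] {A B : Fock n →L[ℂ] F}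
    (h : ∀ w, A (basisVec w) = B (basisVec w)) : A = B := by
  classical
  refine lp.ext_continuousLinearMap (by norm_num) fun w => ?_
  ext
  simpa [basisVec] using h w

/-- The isometry of the Fock space which sends `e_w` to `v w`, for an orthonormal family `v`. -/
def isometryOf {v : FreeMonoid (Fin n) → Fock n} (hv : Orthonormal ℂ v) :
    Fock n →ₗᵢ[ℂ] Fock n :=
  hv.orthogonalFamily.linearIsometry

theorem isometryOf_basisVec {v : FreeMonoid (Fin n) → Fock n} (hv : Orthonormal ℂ v)
    (w : FreeMonoid (Fin n)) : isometryOf hv (basisVec w) = v w := by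
  classical
  simp [isometryOf, basisVec]

theorem of_mul_injective (i : Fin n) :
    Function.Injective fun w : FreeMonoid (Fin n) => FreeMonoid.of i * w :=
  fun _ _ h => mul_left_cancel h

/-- The left creation operator `L_i`, `L_i e_w = e_{iw}`. -/
def creation (i : Fin n) : Fock n →L[ℂ] Fock n :=
  (isometryOf (orthonormal_basisVec.comp _ (of_mul_injective i))).toContinuousLinearMap

theorem creation_basisVec (i : Fin n) (w : FreeMonoid (Fin n)) :
    creation i (basisVec w) = basisVec (FreeMonoid.of i * w) :=
  isometryOf_basisVec (orthonormal_basisVec.comp _ (of_mul_injective i)) w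

open scoped Classical in
theorem inner_basisVec (v w : FreeMonoid (Fin n)) :
    inner ℂ (basisVec v) (basisVec w) = if v = w then (1 : ℂ) else 0 := by
  exact orthonormal_iff_ite.1 orthonormal_basisVec v w

theorem of_mul_eq_iff (i j : Fin n) (v w : FreeMonoid (Fin n)) :
    (FreeMonoid.of i * v = FreeMonoid.of j * w) = (i = j ∧ v = w) := by
  refine propext ⟨fun h => List.cons.inj h, ?_⟩
  rintro ⟨rfl, rfl⟩
  rfl

theorem inner_creation (i j : Fin n) (ξ η : Fock n) :
    inner ℂ (creation i ξ) (creation j η) = if i = j then inner ℂ ξ η else 0 := by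
  have key : (ContinuousLinearMap.adjoint (creation i)) ∘L creation j
      = if i = j then ContinuousLinearMap.id ℂ (Fock n) else 0 := by
    refine fock_ext fun w => ?_
    ext v
    rw [← inner_basisVec_left, ← inner_basisVec_left, ContinuousLinearMap.comp_apply,
      ContinuousLinearMap.adjoint_inner_right, creation_basisVec, creation_basisVec,
      inner_basisVec]
    classical
    rw [if_congr (Iff.of_eq (of_mul_eq_iff i j v w)) rfl rfl]
    by_cases hij : i = j
    · subst hij
      by_cases hvw : v = w
      · simp [hvw, orthonormal_basisVec.1 w]
      · simp [hvw, inner_basisVec]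
    · simp [hij]
  have := congrArg (fun A : Fock n →L[ℂ] Fock n => inner ℂ ξ (A η)) key
  simp only [ContinuousLinearMap.comp_apply, ContinuousLinearMap.adjoint_inner_right] at this
  rw [this]
  split_ifs <;> simp

theorem inner_vacuum_creation (i : Fin n) (ξ : Fock n) :
    inner ℂ (basisVec (1 : FreeMonoid (Fin n))) (creation i ξ) = 0 := by
  have key : (innerSL ℂ (basisVec (1 : FreeMonoid (Fin n)))) ∘L creation i = 0 := by
    refine fock_ext fun w => ?_
    have : (1 : FreeMonoid (Fin n)) ≠ FreeMonoid.of i * w := by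
      intro h
      have := congrArg FreeMonoid.length h
      simp at this
      omega
    simp [creation_basisVec, inner_basisVec, this]
  exact congrArg (fun A : Fock n →L[ℂ] ℂ => A ξ) key

theorem norm_sum_smul_creation (z : Fin n → ℂ) (ξ : Fock n) :
    ‖(∑ j, z j • creation j) ξ‖ ^ 2 = (∑ j, ‖z j‖ ^ 2) * ‖ξ‖ ^ 2 := by
  have : inner ℂ ((∑ j, z j • creation j) ξ) ((∑ j, z j • creation j) ξ)
      = ((∑ j, ‖z j‖ ^ 2 : ℝ) : ℂ) * inner ℂ ξ ξ := by
    simp only [_root_.sum_apply, _root_.smul_apply, sum_inner, inner_sum,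
      inner_smul_left, inner_smul_right, inner_creation]
    simp only [mul_ite, mul_zero, Finset.sum_ite_eq', Finset.mem_univ, if_true]
    push_cast
    rw [Finset.sum_mul]
    refine Finset.sum_congr rfl fun j _ => ?_
    rw [← mul_assoc, mul_comm (z j), mul_comm (conj (z j)), Complex.mul_conj']
  rw [inner_self_eq_norm_sq_to_K, inner_self_eq_norm_sq_to_K] at this
  apply Complex.ofReal_injective
  push_cast
  simpa using this

end Shift

section Moebius

/-- The signature matrix `J = diag(-1, I_n)`. -/
def signature (n : ℕ) : Matrix (Unit ⊕ Fin n) (Unit ⊕ Fin n) ℂ :=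
  Matrix.fromBlocks (-1) 0 0 1

/-- An element of `U(1,n)`: a `J`-unitary matrix of size `n + 1`, i.e. `X* J X = J`. -/
structure U1 (n : ℕ) where
  /-- the matrix -/
  mat : Matrix (Unit ⊕ Fin n) (Unit ⊕ Fin n) ℂ
  isJUnitary : mat.conjTranspose * signature n * mat = signature n

namespace U1

variable {n : ℕ} (X : U1 n)

/-- The scalar corner `x`. -/
def x : ℂ := X.mat (Sum.inl ()) (Sum.inl ())

/-- The row `y`. -/
def y (i : Fin n) : ℂ := X.mat (Sum.inl ()) (Sum.inr i)

/-- The column `zᵗ`. -/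
def z (j : Fin n) : ℂ := X.mat (Sum.inr j) (Sum.inl ())

/-- The block `X'`. -/
def X' (j i : Fin n) : ℂ := X.mat (Sum.inr j) (Sum.inr i)

end U1

section Algebra

variable {n : ℕ} {A : Type*} [Ring A] [Algebra ℂ A]

/-- `x - ∑ z_j a_j`, the element which is inverted in the Möbius transformation of `a`. -/
def denom (X : U1 n) (a : Fin n → A) : A := X.x • 1 - ∑ j, X.z j • a j

/-- The Möbius transformation
`a ↦ (x - ∑ z_j a_j)⁻¹ (∑ a_j X'_{ji} - y_i)`, in any algebra. -/
def moebius (X : U1 n) (a : Fin n → A) (i : Fin n) : A :=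
  Ring.inverse (denom X a) * (∑ j, X.X' j i • a j - X.y i • 1)

end Algebra

variable {n : ℕ}

theorem signature_mul_self : signature n * signature n = 1 := by
  simp [signature, Matrix.fromBlocks_multiply]

theorem signature_conjTranspose : (signature n).conjTranspose = signature n := by
  simp [signature, Matrix.fromBlocks_conjTranspose]

/-- The inverse matrix `J X* J`. -/
def U1.inv (X : U1 n) : U1 n :=
  ⟨signature n * X.mat.conjTranspose * signature n, by
    have h1 : signature n * X.mat.conjTranspose * signature n * X.mat = 1 := by
      rw [mul_assoc, mul_assoc, ← mul_assoc X.mat.conjTranspose, X.isJUnitary, signature_mul_self]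
    have h2 : X.mat * (signature n * X.mat.conjTranspose * signature n) = 1 :=
      mul_eq_one_comm.1 h1
    rw [Matrix.conjTranspose_mul, Matrix.conjTranspose_mul, Matrix.conjTranspose_conjTranspose,
      signature_conjTranspose]
    calc signature n * (X.mat * signature n) * signature n
          * (signature n * X.mat.conjTranspose * signature n)
        = signature n * (X.mat * (signature n * signature n)
          * (signature n * X.mat.conjTranspose * signature n)) := by simp only [mul_assoc]
      _ = signature n := by rw [signature_mul_self, mul_one, h2, mul_one]⟩

theorem U1.mul_inv (X : U1 n) : X.mat * X.inv.mat = 1 := by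
  refine mul_eq_one_comm.1 ?_
  change signature n * X.mat.conjTranspose * signature n * X.mat = 1
  rw [mul_assoc, mul_assoc, ← mul_assoc X.mat.conjTranspose, X.isJUnitary, signature_mul_self]

theorem U1.conj_sum (X : U1 n) (b c : Unit ⊕ Fin n) :
    -(conj (X.mat (Sum.inl ()) b) * X.mat (Sum.inl ()) c)
      + ∑ j, conj (X.mat (Sum.inr j) b) * X.mat (Sum.inr j) c = signature n b c := by
  have h := congrFun (congrFun X.isJUnitary b) c
  rw [← h, Matrix.mul_apply, Fintype.sum_sum_type]
  simp [Matrix.mul_apply, signature, Fintype.sum_sum_type, Matrix.one_apply]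

theorem U1.norm_sq (X : U1 n) : ‖X.x‖ ^ 2 = 1 + ∑ j, ‖X.z j‖ ^ 2 := by
  have h := X.conj_sum (Sum.inl ()) (Sum.inl ())
  simp only [signature, Matrix.fromBlocks_apply₁₁, Matrix.neg_apply, Matrix.one_apply_eq,
    ← Complex.normSq_eq_conj_mul_self, Complex.normSq_eq_norm_sq] at h
  have h' : -‖X.x‖ ^ 2 + ∑ j, ‖X.z j‖ ^ 2 = -1 := by
    apply Complex.ofReal_injective
    push_cast
    simpa [U1.x, U1.z] using h
  linarith

theorem U1.norm_z_lt (X : U1 n) : ‖∑ j, X.z j • creation j‖ < ‖X.x‖ := by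
  have h1 : ‖∑ j, X.z j • creation j‖ ≤ Real.sqrt (∑ j, ‖X.z j‖ ^ 2) := by
    refine ContinuousLinearMap.opNorm_le_bound _ (Real.sqrt_nonneg _) fun ξ => ?_
    refine le_of_sq_le_sq ?_ (by positivity)
    rw [norm_sum_smul_creation, mul_pow, Real.sq_sqrt (by positivity)]
  refine h1.trans_lt ?_
  rw [Real.sqrt_lt' (by
    have := X.norm_sq
    have h2 : 0 ≤ ∑ j, ‖X.z j‖ ^ 2 := by positivity
    by_contra hx
    have h3 : ‖X.x‖ = 0 := le_antisymm (not_lt.1 hx) (norm_nonneg _)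
    rw [h3] at this
    linarith)]
  rw [X.norm_sq]
  linarith

/-- The invariance of the indefinite form under a `J`-unitary matrix acting on vectors with
entries in a Hilbert space. -/
theorem U1.inner_invariant {E : Type*} [NormedAddCommGroup E] [InnerProductSpace ℂ E] (X : U1 n)
    (p q : Unit ⊕ Fin n → E) :
    -inner ℂ (∑ b, X.mat (Sum.inl ()) b • p b) (∑ b, X.mat (Sum.inl ()) b • q b)
      + ∑ j, inner ℂ (∑ b, X.mat (Sum.inr j) b • p b) (∑ b, X.mat (Sum.inr j) b • q b)
    = -inner ℂ (p (Sum.inl ())) (q (Sum.inl ())) + ∑ j, inner ℂ (p (Sum.inr j)) (q (Sum.inr j)) := by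
  have h : ∀ a, inner ℂ (∑ b, X.mat a b • p b) (∑ b, X.mat a b • q b)
      = ∑ b, ∑ c, (conj (X.mat a b) * X.mat a c) * inner ℂ (p b) (q c) := by
    intro a
    simp only [sum_inner, inner_sum, inner_smul_left, inner_smul_right, Finset.mul_sum]
    rw [Finset.sum_comm]
    refine Finset.sum_congr rfl fun b _ => Finset.sum_congr rfl fun c _ => by ring
  simp only [h]
  have e1 : (-∑ b, ∑ c, (conj (X.mat (Sum.inl ()) b) * X.mat (Sum.inl ()) c) * inner ℂ (p b) (q c))
      + ∑ j : Fin n, ∑ b, ∑ c, (conj (X.mat (Sum.inr j) b) * X.mat (Sum.inr j) c) * inner ℂ (p b) (q c)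
      = ∑ b, ∑ c, signature n b c * inner ℂ (p b) (q c) := by
    rw [Finset.sum_comm (s := (Finset.univ : Finset (Fin n))), ← Finset.sum_neg_distrib,
      ← Finset.sum_add_distrib]
    refine Finset.sum_congr rfl fun b _ => ?_
    rw [Finset.sum_comm (s := (Finset.univ : Finset (Fin n))), ← Finset.sum_neg_distrib, ← Finset.sum_add_distrib]
    refine Finset.sum_congr rfl fun c _ => ?_
    rw [← X.conj_sum b c, ← Finset.sum_mul]
    ring
  rw [e1]
  simp [signature, Fintype.sum_sum_type, Matrix.one_apply]

theorem isUnit_denom_creation (X : U1 n) : IsUnit (denom X (creation (n := n))) := by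
  have := spectrum.mem_resolventSet_of_norm_lt_mul (𝕜 := ℂ) (A := Fock n →L[ℂ] Fock n)
    (a := ∑ j, X.z j • creation j) (k := X.x) (by
      refine lt_of_le_of_lt (mul_le_of_le_one_right (norm_nonneg _) ?_) X.norm_z_lt
      exact ContinuousLinearMap.norm_id_le)
  rw [spectrum.mem_resolventSet_iff, Algebra.algebraMap_eq_smul_one] at this
  exact this

end Moebius

section Unitary

variable {n : ℕ} (X : U1 n)

local notation "𝔏op" => Fock n →L[ℂ] Fock n

theorem denom_mul_moebius (i : Fin n) :
    denom X creation * moebius X creation i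
      = ∑ j, X.X' j i • (creation j : 𝔏op) - X.y i • 1 := by
  rw [moebius, ← mul_assoc, Ring.mul_inverse_cancel _ (isUnit_denom_creation X), one_mul]

/-- The unit vector `(x - L[z])⁻¹ e_∅`. -/
def vacuumImage : Fock n := Ring.inverse (denom X (creation (n := n))) (basisVec 1)

theorem denom_vacuumImage : denom X creation (vacuumImage X) = basisVec 1 := by
  have := Ring.mul_inverse_cancel _ (isUnit_denom_creation X)
  exact congrArg (fun A : 𝔏op => A (basisVec 1)) this

/-- The indefinite form of two vectors whose images under `X` have the form
`(c + ∑ L_j k_j, k)` is `-⟨c, d⟩`. -/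
theorem form_eq (p q : Unit ⊕ Fin n → Fock n) (s t : ℂ)
    (hp : ∑ b, X.mat (Sum.inl ()) b • p b
      = s • basisVec 1 + ∑ j, creation j (∑ b, X.mat (Sum.inr j) b • p b))
    (hq : ∑ b, X.mat (Sum.inl ()) b • q b
      = t • basisVec 1 + ∑ j, creation j (∑ b, X.mat (Sum.inr j) b • q b)) :
    -inner ℂ (p (Sum.inl ())) (q (Sum.inl ())) + ∑ j, inner ℂ (p (Sum.inr j)) (q (Sum.inr j))
      = -(conj s * t) := by
  classical
  rw [← X.inner_invariant p q, hp, hq]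
  have h0 : ∀ (j : Fin n) (ξ : Fock n), inner ℂ (creation j ξ) (basisVec 1) = 0 := fun j ξ => by
    rw [← inner_conj_symm, inner_vacuum_creation, map_zero]
  simp only [inner_add_left, inner_add_right, inner_smul_left, inner_smul_right, inner_sum,
    sum_inner, h0, inner_vacuum_creation, inner_creation, inner_basisVec]
  simp [mul_comm]

theorem row_moebius (i : Fin n) (ξ : Fock n) :
    ∑ b, X.mat (Sum.inl ()) b • (Sum.elim (fun _ => moebius X creation i ξ)
        (Pi.single i ξ) : Unit ⊕ Fin n → Fock n) b
      = (0 : ℂ) • basisVec 1 + ∑ j, creation j (∑ b, X.mat (Sum.inr j) b •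
        (Sum.elim (fun _ => moebius X creation i ξ) (Pi.single i ξ) : Unit ⊕ Fin n → Fock n) b) := by
  have h := congrArg (fun A : 𝔏op => A ξ) (denom_mul_moebius X i)
  simp only [denom, U1.x, U1.y, U1.z, U1.X', mul_apply_eq_comp, _root_.sub_apply,
    _root_.smul_apply, _root_.sum_apply, one_apply_eq_self] at h
  simp only [Fintype.sum_sum_type, Finset.univ_unique, Finset.sum_singleton, Sum.elim_inl,
    Sum.elim_inr, Pi.single_apply, smul_ite, smul_zero, Finset.sum_ite_eq', Finset.mem_univ,
    if_true, map_add, map_smul, Finset.sum_add_distrib, zero_smul, zero_add]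
  rw [sub_eq_sub_iff_add_eq_add] at h
  rw [add_comm (∑ j, _)]
  exact h

theorem row_vacuumImage :
    ∑ b, X.mat (Sum.inl ()) b • (Sum.elim (fun _ => vacuumImage X)
        (fun _ => 0) : Unit ⊕ Fin n → Fock n) b
      = (1 : ℂ) • basisVec 1 + ∑ j, creation j (∑ b, X.mat (Sum.inr j) b •
        (Sum.elim (fun _ => vacuumImage X) (fun _ => 0) : Unit ⊕ Fin n → Fock n) b) := by
  have h := denom_vacuumImage X
  simp only [denom, U1.x, U1.z, _root_.sub_apply, _root_.smul_apply, _root_.sum_apply,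
    one_apply_eq_self] at h
  simp only [Fintype.sum_sum_type, Finset.univ_unique, Finset.sum_singleton, Sum.elim_inl,
    Sum.elim_inr, smul_zero, Finset.sum_const_zero, add_zero, map_smul, one_smul]
  exact sub_eq_iff_eq_add.1 h

theorem inner_moebius (i j : Fin n) (ξ η : Fock n) :
    inner ℂ (moebius X creation i ξ) (moebius X creation j η)
      = if i = j then inner ℂ ξ η else 0 := by
  have h := form_eq X _ _ 0 0 (row_moebius X i ξ) (row_moebius X j η)
  simp only [Sum.elim_inl, Sum.elim_inr, map_zero, mul_zero, neg_zero] at h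
  rw [neg_add_eq_zero] at h
  rw [h, Finset.sum_eq_single j]
  · by_cases hij : i = j
    · subst hij; simp
    · simp [hij, Ne.symm hij]
  · intro k _ hk
    simp [Pi.single_apply, hk]
  · simp

theorem inner_vacuumImage_moebius (j : Fin n) (η : Fock n) :
    inner ℂ (vacuumImage X) (moebius X creation j η) = 0 := by
  have h := form_eq X _ _ 1 0 (row_vacuumImage X) (row_moebius X j η)
  simpa using h

theorem inner_vacuumImage : inner ℂ (vacuumImage X) (vacuumImage X) = 1 := by
  have h := form_eq X _ _ 1 1 (row_vacuumImage X) (row_vacuumImage X)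
  simpa using h

/-- `Φ_X(L_w) (x - L[z])⁻¹ e_∅`, the image of `e_w` under `U_X`. -/
def unitaryVec (w : FreeMonoid (Fin n)) : Fock n :=
  FreeMonoid.lift (moebius X (creation (n := n))) w (vacuumImage X)

theorem unitaryVec_of_mul (i : Fin n) (w : FreeMonoid (Fin n)) :
    unitaryVec X (FreeMonoid.of i * w) = moebius X creation i (unitaryVec X w) := by
  simp [unitaryVec]

theorem orthonormal_unitaryVec : Orthonormal ℂ (unitaryVec X) := by
  classical
  have h1 : unitaryVec X 1 = vacuumImage X := by simp [unitaryVec]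
  rw [orthonormal_iff_ite]
  intro v
  induction v using FreeMonoid.inductionOn' with
  | one =>
    intro w
    induction w using FreeMonoid.inductionOn' with
    | one => rw [h1, inner_vacuumImage, if_pos rfl]
    | of_mul j w _ =>
      have : (1 : FreeMonoid (Fin n)) ≠ FreeMonoid.of j * w := by
        intro h
        have := congrArg FreeMonoid.length h
        simp at this
        omega
      rw [h1, unitaryVec_of_mul, inner_vacuumImage_moebius, if_neg this]
  | of_mul i v ih =>
    intro w
    induction w using FreeMonoid.inductionOn' with
    | one =>
      have : FreeMonoid.of i * v ≠ 1 := by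
        intro h
        have := congrArg FreeMonoid.length h
        simp at this
      rw [h1, unitaryVec_of_mul, ← inner_conj_symm, inner_vacuumImage_moebius, if_neg this,
        map_zero]
    | of_mul j w _ =>
      rw [unitaryVec_of_mul, unitaryVec_of_mul, inner_moebius, ih]
      rw [if_congr (Iff.of_eq (of_mul_eq_iff i j v w)) rfl rfl]
      by_cases hij : i = j <;> by_cases hvw : v = w <;> simp [hij, hvw]

/-- `U_X` as an isometry. -/
def isometryU : Fock n →ₗᵢ[ℂ] Fock n := isometryOf (orthonormal_unitaryVec X)

theorem isometryU_basisVec (w : FreeMonoid (Fin n)) :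
    isometryU X (basisVec w) = unitaryVec X w := isometryOf_basisVec _ w

theorem isometryU_creation (i : Fin n) :
    (isometryU X).toContinuousLinearMap * creation i
      = moebius X creation i * (isometryU X).toContinuousLinearMap := by
  refine fock_ext fun w => ?_
  simp [creation_basisVec, isometryU_basisVec, unitaryVec_of_mul]

/-- The row `(1, -L)`. -/
def rowOp : Unit ⊕ Fin n → 𝔏op := Sum.elim (fun _ => 1) (fun j => -creation j)

theorem sum_rowOp_inl : ∑ a, X.mat a (Sum.inl ()) • rowOp a = denom X (creation (n := n)) := by
  simp [denom, rowOp, Fintype.sum_sum_type, U1.x, U1.z, sub_eq_add_neg]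

theorem sum_rowOp_inr (i : Fin n) : ∑ a, X.mat a (Sum.inr i) • rowOp a
    = -(∑ j, X.X' j i • (creation j : 𝔏op) - X.y i • 1) := by
  simp [rowOp, Fintype.sum_sum_type, U1.y, U1.X', sub_eq_add_neg, add_comm]

/-- The row `(1, -Φ_X(L))`. -/
def rowMoebius : Unit ⊕ Fin n → 𝔏op := Sum.elim (fun _ => 1) (fun j => -moebius X creation j)

theorem denom_mul_rowMoebius (b : Unit ⊕ Fin n) :
    denom X creation * rowMoebius X b = ∑ a, X.mat a b • rowOp a := by
  rcases b with ⟨⟩ | i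
  · rw [sum_rowOp_inl]; simp [rowMoebius]
  · rw [sum_rowOp_inr, ← denom_mul_moebius]; simp [rowMoebius]

theorem denom_mul_sum (c : Unit ⊕ Fin n) :
    denom X creation * ∑ b, X.inv.mat b c • rowMoebius X b = rowOp c := by
  rw [Finset.mul_sum]
  simp only [mul_smul_comm, denom_mul_rowMoebius, Finset.smul_sum, smul_smul]
  rw [Finset.sum_comm]
  simp only [← Finset.sum_smul]
  have : ∀ a, ∑ b, X.inv.mat b c * X.mat a b = if a = c then 1 else 0 := by
    intro a
    have h := congrFun (congrFun X.mul_inv a) c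
    rw [Matrix.mul_apply, Matrix.one_apply] at h
    rw [← h]
    exact Finset.sum_congr rfl fun b _ => mul_comm _ _
  simp [this]

theorem isometryU_rowOp (c : Unit ⊕ Fin n) :
    (isometryU X).toContinuousLinearMap * rowOp c
      = rowMoebius X c * (isometryU X).toContinuousLinearMap := by
  rcases c with ⟨⟩ | i
  · simp [rowOp, rowMoebius]
  · simp [rowOp, rowMoebius, isometryU_creation]

theorem denom_mul_isometryU (c : Unit ⊕ Fin n) :
    denom X creation * ((isometryU X).toContinuousLinearMap * ∑ b, X.inv.mat b c • rowOp b)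
      = rowOp c * (isometryU X).toContinuousLinearMap := by
  rw [← denom_mul_sum X c, mul_assoc]
  congr 1
  rw [Finset.mul_sum, Finset.sum_mul]
  refine Finset.sum_congr rfl fun b _ => ?_
  rw [mul_smul_comm, isometryU_rowOp, smul_mul_assoc]

theorem denom_comp_isometryU :
    denom X creation * (isometryU X).toContinuousLinearMap
      = (isometryU X).toContinuousLinearMap * Ring.inverse (denom X.inv creation) := by
  have h := denom_mul_isometryU X (Sum.inl ())
  rw [sum_rowOp_inl] at h
  have h2 : (rowOp (Sum.inl ()) : 𝔏op) = 1 := rfl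
  rw [h2, one_mul] at h
  have := congrArg (fun A : 𝔏op => A * Ring.inverse (denom X.inv creation)) h
  simp only [mul_assoc] at this
  rwa [Ring.mul_inverse_cancel _ (isUnit_denom_creation X.inv), mul_one] at this

theorem creation_mul_isometryU (i : Fin n) :
    creation i * (isometryU X).toContinuousLinearMap
      = (isometryU X).toContinuousLinearMap * moebius X.inv creation i := by
  have h := denom_mul_isometryU X (Sum.inr i)
  have h2 : (rowOp (Sum.inr i) : 𝔏op) = -creation i := rfl
  rw [sum_rowOp_inr, h2, ← mul_assoc, denom_comp_isometryU, mul_assoc, mul_neg, mul_neg, neg_mul,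
    neg_inj] at h
  exact h.symm

theorem isometryU_surjective : Function.Surjective (isometryU X) := by
  have hcl : IsClosed (Set.range (isometryU X)) :=
    (isometryU X).isometry.isClosedEmbedding.isClosed_range
  have hmem : ∀ w, basisVec w ∈ LinearMap.range (isometryU X).toLinearMap := by
    intro w
    induction w using FreeMonoid.inductionOn' with
    | one =>
      refine ⟨Ring.inverse (denom X.inv creation) (basisVec 1), ?_⟩
      have h := congrArg (fun A : 𝔏op => A (basisVec 1)) (denom_comp_isometryU X)
      have h1 : isometryU X (basisVec 1) = vacuumImage X := by
        rw [isometryU_basisVec]; simp [unitaryVec]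
      simp only [mul_apply_eq_comp, LinearIsometry.coe_toContinuousLinearMap, h1,
        denom_vacuumImage] at h
      exact h.symm
    | of_mul i w ih =>
      obtain ⟨ξ, hξ⟩ := ih
      refine ⟨moebius X.inv creation i ξ, ?_⟩
      have h := congrArg (fun A : 𝔏op => A ξ) (creation_mul_isometryU X i)
      simp only [mul_apply_eq_comp, LinearIsometry.coe_toContinuousLinearMap] at h
      rw [← creation_basisVec, ← hξ]
      exact h.symm
  intro f
  classical
  have hs : HasSum (fun w => f w • basisVec w) f := by
    have := lp.hasSum_single (E := fun _ : FreeMonoid (Fin n) => ℂ) (p := 2) (by norm_num) f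
    convert this using 2 with w
    rw [basisVec, ← lp.single_smul]
    simp
  have : f ∈ closure (Set.range (isometryU X)) := by
    refine mem_closure_of_tendsto hs (Filter.Eventually.of_forall fun s => ?_)
    exact Submodule.sum_mem (LinearMap.range (isometryU X).toLinearMap) fun w _ =>
      Submodule.smul_mem _ _ (hmem w)
  rwa [hcl.closure_eq] at this

/-- The unitary operator `U_X` of the Fock space, determined by
`U_X e_w = Φ_X(L_w) (x - L[z])⁻¹ e_∅`, where `Φ_X(L_w)` is the product along `w` of
`Φ_X(L_i) = (x - L[z])⁻¹ (∑ X'_{ji} L_j - y_i)`. -/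
def unitaryU : Fock n ≃ₗᵢ[ℂ] Fock n :=
  LinearIsometryEquiv.ofSurjective (isometryU X) (isometryU_surjective X)

theorem unitaryU_basisVec (w : FreeMonoid (Fin n)) :
    unitaryU X (basisVec w)
      = FreeMonoid.lift (moebius X creation) w
          (Ring.inverse (denom X (creation (n := n))) (basisVec 1)) :=
  isometryU_basisVec X w

/-- Conjugation by `U_X`, `A ↦ U_X A U_X*`. -/
def conjU : 𝔏op ≃⋆ₐ[ℂ] 𝔏op := (unitaryU X).conjStarAlgEquiv

theorem conjU_creation (i : Fin n) : conjU X (creation i) = moebius X creation i := by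
  ext1 ξ
  obtain ⟨η, rfl⟩ := (unitaryU X).surjective ξ
  rw [conjU, LinearIsometryEquiv.conjStarAlgEquiv_apply_apply, LinearIsometryEquiv.symm_apply_apply]
  exact congrArg (fun A : 𝔏op => A η) (isometryU_creation X i)

theorem conjU_symm_creation (i : Fin n) :
    (conjU X).symm (creation i) = moebius X.inv creation i := by
  rw [StarAlgEquiv.symm_apply_eq]
  ext1 ξ
  obtain ⟨η, rfl⟩ := (unitaryU X).surjective ξ
  rw [conjU, LinearIsometryEquiv.conjStarAlgEquiv_apply_apply, LinearIsometryEquiv.symm_apply_apply]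
  exact congrArg (fun A : 𝔏op => A η) (creation_mul_isometryU X i)

end Unitary

section Algebras

variable {n : ℕ}

local notation "𝔏op" => Fock n →L[ℂ] Fock n

/-- The norm-closed unital algebra `𝔩_n` generated by the left creation operators. -/
def discAlgebra (n : ℕ) : Subalgebra ℂ (Fock n →L[ℂ] Fock n) :=
  (Algebra.adjoin ℂ (Set.range (creation (n := n)))).topologicalClosure

/-- The unital algebra `𝔏_n` generated by the left creation operators and closed in the weak
operator topology. -/
def toeplitzAlgebra (n : ℕ) : Subalgebra ℂ (Fock n →L[ℂ] Fock n) :=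
  ((Algebra.adjoin ℂ (Set.range fun i : Fin n =>
    ContinuousLinearMapWOT.ofCLM (creation i))).topologicalClosure).comap
      (ContinuousLinearMapWOT.algEquiv (𝕜₁ := ℂ) (E := Fock n) ℂ).symm.toAlgHom

theorem creation_mem_disc (i : Fin n) : creation i ∈ discAlgebra n :=
  Subalgebra.le_topologicalClosure _ (Algebra.subset_adjoin ⟨i, rfl⟩)

theorem isClosed_discAlgebra : IsClosed (discAlgebra n : Set 𝔏op) :=
  Subalgebra.isClosed_topologicalClosure _

theorem mem_toeplitz_iff (A : 𝔏op) : A ∈ toeplitzAlgebra n ↔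
    ContinuousLinearMapWOT.ofCLM A ∈ closure (ContinuousLinearMapWOT.ofCLM ''
      (Algebra.adjoin ℂ (Set.range (creation (n := n))) : Set 𝔏op)) := by
  have h : Algebra.adjoin ℂ (Set.range fun i : Fin n => ContinuousLinearMapWOT.ofCLM (creation i))
      = (Algebra.adjoin ℂ (Set.range (creation (n := n)))).map
        (ContinuousLinearMapWOT.algEquiv (𝕜₁ := ℂ) (E := Fock n) ℂ).symm.toAlgHom := by
    rw [AlgHom.map_adjoin, ← Set.range_comp]
    rfl
  rw [toeplitzAlgebra, h]
  rfl

theorem disc_le_toeplitz : discAlgebra n ≤ toeplitzAlgebra n := by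
  intro A hA
  rw [mem_toeplitz_iff]
  exact image_closure_subset_closure_image ContinuousLinearMapWOT.continuous_ofCLM ⟨A, hA, rfl⟩

instance : CompleteSpace (discAlgebra n) := isClosed_discAlgebra.completeSpace_coe

theorem moebius_mem_disc (X : U1 n) (i : Fin n) : moebius X creation i ∈ discAlgebra n := by
  refine mul_mem ?_ ?_
  · have hz : ∑ j, X.z j • creation j ∈ discAlgebra n :=
      sum_mem fun j _ => Subalgebra.smul_mem _ (creation_mem_disc j) _
    have hu := spectrum.mem_resolventSet_of_norm_lt_mul (𝕜 := ℂ) (A := discAlgebra n)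
      (a := ⟨_, hz⟩) (k := X.x) (by
        refine lt_of_le_of_lt (mul_le_of_le_one_right (norm_nonneg _) ?_) X.norm_z_lt
        exact ContinuousLinearMap.norm_id_le)
    rw [spectrum.mem_resolventSet_iff, Algebra.algebraMap_eq_smul_one] at hu
    obtain ⟨u, hu⟩ := hu
    have h2 : denom X creation = ((u : discAlgebra n) : 𝔏op) := by rw [hu]; rfl
    have h3 : denom X creation = (Units.map (discAlgebra n).val.toMonoidHom u : 𝔏opˣ) := h2
    rw [h3, Ring.inverse_unit, ← map_inv]
    exact ((u⁻¹ : (discAlgebra n)ˣ) : discAlgebra n).2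
  · exact sub_mem (sum_mem fun j _ => Subalgebra.smul_mem _ (creation_mem_disc j) _)
      (Subalgebra.smul_mem _ (one_mem _) _)

theorem conjU_adjoin_le (X : U1 n) {A : 𝔏op}
    (hA : A ∈ Algebra.adjoin ℂ (Set.range (creation (n := n)))) :
    conjU X A ∈ discAlgebra n ∧ (conjU X).symm A ∈ discAlgebra n := by
  have h1 : Algebra.adjoin ℂ (Set.range (creation (n := n)))
      ≤ (discAlgebra n).comap ((conjU X : 𝔏op ≃⋆ₐ[ℂ] 𝔏op) : 𝔏op →ₐ[ℂ] 𝔏op) := by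
    refine Algebra.adjoin_le ?_
    rintro _ ⟨i, rfl⟩
    change conjU X (creation i) ∈ discAlgebra n
    rw [conjU_creation]
    exact moebius_mem_disc X i
  have h2 : Algebra.adjoin ℂ (Set.range (creation (n := n)))
      ≤ (discAlgebra n).comap (((conjU X).symm : 𝔏op ≃⋆ₐ[ℂ] 𝔏op) : 𝔏op →ₐ[ℂ] 𝔏op) := by
    refine Algebra.adjoin_le ?_
    rintro _ ⟨i, rfl⟩
    change (conjU X).symm (creation i) ∈ discAlgebra n
    rw [conjU_symm_creation]
    exact moebius_mem_disc X.inv i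
  exact ⟨h1 hA, h2 hA⟩

theorem conjU_mem_disc (X : U1 n) (A : 𝔏op) (hA : A ∈ discAlgebra n) : conjU X A ∈ discAlgebra n :=
  map_mem_closure (unitaryU X).toContinuousLinearEquiv.conjContinuousAlgEquiv.continuous hA
    (fun _ h => (conjU_adjoin_le X h).1) |> isClosed_discAlgebra.closure_subset

theorem conjU_symm_mem_disc (X : U1 n) (A : 𝔏op) (hA : A ∈ discAlgebra n) :
    (conjU X).symm A ∈ discAlgebra n :=
  map_mem_closure (unitaryU X).toContinuousLinearEquiv.conjContinuousAlgEquiv.symm.continuous hA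
    (fun _ h => (conjU_adjoin_le X h).2) |> isClosed_discAlgebra.closure_subset

theorem conj_mem_toeplitz (B C : 𝔏op)
    (h : ∀ A ∈ Algebra.adjoin ℂ (Set.range (creation (n := n))), B * A * C ∈ toeplitzAlgebra n)
    (A : 𝔏op) (hA : A ∈ toeplitzAlgebra n) : B * A * C ∈ toeplitzAlgebra n := by
  rw [mem_toeplitz_iff] at hA ⊢
  have hc : Continuous fun D : Fock n →WOT[ℂ] Fock n =>
      ContinuousLinearMapWOT.ofCLM B * D * ContinuousLinearMapWOT.ofCLM C :=
    (continuous_mul_const _).comp (continuous_const_mul _)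
  have := map_mem_closure hc hA (t := ContinuousLinearMapWOT.ofCLM '' (toeplitzAlgebra n : Set 𝔏op))
    (by rintro _ ⟨D, hD, rfl⟩; exact ⟨_, h D hD, rfl⟩)
  refine closure_minimal ?_ isClosed_closure this
  rintro _ ⟨D, hD, rfl⟩
  exact (mem_toeplitz_iff D).1 hD

theorem conjU_mem_toeplitz (X : U1 n) (A : 𝔏op) (hA : A ∈ toeplitzAlgebra n) :
    conjU X A ∈ toeplitzAlgebra n :=
  conj_mem_toeplitz (unitaryU X) (unitaryU X).symm
    (fun _ h => disc_le_toeplitz (conjU_adjoin_le X h).1) A hA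

theorem conjU_symm_mem_toeplitz (X : U1 n) (A : 𝔏op) (hA : A ∈ toeplitzAlgebra n) :
    (conjU X).symm A ∈ toeplitzAlgebra n :=
  conj_mem_toeplitz (unitaryU X).symm (unitaryU X)
    (fun _ h => disc_le_toeplitz (conjU_adjoin_le X h).2) A hA

/-- Restriction of an automorphism of an algebra to an invariant subalgebra. -/
def restrictAut {A : Type*} [Ring A] [Algebra ℂ A] (e : A ≃ₐ[ℂ] A) (S : Subalgebra ℂ A)
    (h : ∀ a ∈ S, e a ∈ S) (h' : ∀ a ∈ S, e.symm a ∈ S) : S ≃ₐ[ℂ] S where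
  toFun a := ⟨e a, h a a.2⟩
  invFun a := ⟨e.symm a, h' a a.2⟩
  left_inv a := Subtype.ext (e.symm_apply_apply a)
  right_inv a := Subtype.ext (e.apply_symm_apply a)
  map_mul' a b := Subtype.ext (map_mul e (a : A) b)
  map_add' a b := Subtype.ext (map_add e (a : A) b)
  commutes' r := Subtype.ext (e.commutes r)

/-- The automorphism `Φ_X` of `𝔩_n`, `Φ_X(A) = U_X A U_X*`. -/
def autDisc (X : U1 n) : discAlgebra n ≃ₐ[ℂ] discAlgebra n :=
  restrictAut (conjU X).toAlgEquiv (discAlgebra n) (conjU_mem_disc X) (conjU_symm_mem_disc X)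

/-- The automorphism `Φ_X` of `𝔏_n`, `Φ_X(A) = U_X A U_X*`. -/
def autToeplitz (X : U1 n) : toeplitzAlgebra n ≃ₐ[ℂ] toeplitzAlgebra n :=
  restrictAut (conjU X).toAlgEquiv (toeplitzAlgebra n) (conjU_mem_toeplitz X)
    (conjU_symm_mem_toeplitz X)

/-- The left creation operator as an element of `𝔩_n`. -/
def genDisc (i : Fin n) : discAlgebra n := ⟨creation i, creation_mem_disc i⟩

/-- `Φ_X(L_i) = (x - L[z])⁻¹ (∑ X'_{ji} L_j - y_i)`. -/
theorem coe_autDisc_genDisc (X : U1 n) (i : Fin n) :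
    (autDisc X (genDisc i) : 𝔏op) = moebius X creation i := conjU_creation X i

end Algebras

section Word

variable {n : ℕ} {H : Type*} [NormedAddCommGroup H] [InnerProductSpace ℂ H]

/-- The operator `T_w = T_{i_1} ⋯ T_{i_k}` attached to the word `w = i_1 ⋯ i_k`. -/
def wordOp (T : Fin n → H →L[ℂ] H) (w : FreeMonoid (Fin n)) : H →L[ℂ] H :=
  FreeMonoid.lift T w

theorem wordOp_of_mul (T : Fin n → H →L[ℂ] H) (i : Fin n) (w : FreeMonoid (Fin n)) :
    wordOp T (FreeMonoid.of i * w) = T i * wordOp T w := by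
  simp [wordOp]

end Word

section Calculus

variable {n : ℕ} {H : Type*} [NormedAddCommGroup H] [InnerProductSpace ℂ H] [CompleteSpace H]

/-- `T = (T_1, …, T_n)` is a multicontraction (row contraction): `∑ T_i T_i* ≤ 1`. -/
def IsMulticontraction (T : Fin n → H →L[ℂ] H) : Prop :=
  ∑ i, T i * ContinuousLinearMap.adjoint (T i) ≤ 1

theorem sum_norm_adjoint_sq_le {T : Fin n → H →L[ℂ] H} (hT : IsMulticontraction T) (h : H) :
    ∑ i, ‖ContinuousLinearMap.adjoint (T i) h‖ ^ 2 ≤ ‖h‖ ^ 2 := by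
  have h1 := (ContinuousLinearMap.le_def _ _).1 hT
  have h2 := h1.re_inner_nonneg_right h
  simp only [_root_.sub_apply, one_apply_eq_self, _root_.sum_apply, mul_apply_eq_comp, inner_sub_right,
    inner_sum, ← ContinuousLinearMap.adjoint_inner_left, inner_self_eq_norm_sq_to_K] at h2
  have h3 : 0 ≤ ‖h‖ ^ 2 - ∑ i, ‖ContinuousLinearMap.adjoint (T i) h‖ ^ 2 := by
    have e : ((‖h‖ ^ 2 - ∑ i, ‖ContinuousLinearMap.adjoint (T i) h‖ ^ 2 : ℝ) : ℂ)
      = (‖h‖ : ℂ) ^ 2 - ∑ i, (‖ContinuousLinearMap.adjoint (T i) h‖ : ℂ) ^ 2 := by push_cast; rfl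
    rw [← Complex.ofReal_re (‖h‖ ^ 2 - _), e]
    exact h2
  linarith

/-- The defect operator `D_{T*} = (1 - ∑ T_i T_i*)^{1/2}`. -/
def defect (T : Fin n → H →L[ℂ] H) : H →L[ℂ] H :=
  CFC.sqrt (1 - ∑ i, T i * ContinuousLinearMap.adjoint (T i))

theorem norm_defect_sq {T : Fin n → H →L[ℂ] H} (hT : IsMulticontraction T) (h : H) :
    ‖defect T h‖ ^ 2 + ∑ i, ‖ContinuousLinearMap.adjoint (T i) h‖ ^ 2 = ‖h‖ ^ 2 := by
  have hs : defect T * defect T = 1 - ∑ i, T i * ContinuousLinearMap.adjoint (T i) :=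
    CFC.sqrt_mul_sqrt_self _ (sub_nonneg.2 hT)
  have hsa : ContinuousLinearMap.adjoint (defect T) = defect T :=
    (CFC.sqrt_nonneg _).isSelfAdjoint
  have h1 : inner ℂ (defect T h) (defect T h)
      = inner ℂ h h - ∑ i, inner ℂ (ContinuousLinearMap.adjoint (T i) h)
        (ContinuousLinearMap.adjoint (T i) h) := by
    nth_rewrite 1 [← hsa]
    rw [ContinuousLinearMap.adjoint_inner_left]
    have := congrArg (fun A : H →L[ℂ] H => A h) hs
    simp only [mul_apply_eq_comp] at this
    rw [this]
    simp only [_root_.sub_apply, one_apply_eq_self, _root_.sum_apply, mul_apply_eq_comp,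
      inner_sub_right, inner_sum, ContinuousLinearMap.adjoint_inner_left]
  simp only [inner_self_eq_norm_sq_to_K] at h1
  apply Complex.ofReal_injective
  push_cast
  exact eq_sub_iff_add_eq.1 h1

theorem enorm_sq_lp {ι : Type*} (f : lp (fun _ : ι => ℂ) 2) : ‖f‖ₑ ^ 2 = ∑' i, ‖f i‖ₑ ^ 2 := by
  have h := lp.hasSum_norm (p := 2) (by norm_num) f
  simp only [ENNReal.toReal_ofNat, Real.rpow_ofNat] at h
  have h2 := ENNReal.ofReal_tsum_of_nonneg (fun i => by positivity) h.summable
  rw [h.tsum_eq] at h2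
  simpa [ENNReal.ofReal_pow, ofReal_norm] using h2

/-- The splitting of a nonempty word into its first letter and the remainder. -/
def wordEquiv (n : ℕ) : Unit ⊕ (Fin n × FreeMonoid (Fin n)) ≃ FreeMonoid (Fin n) where
  toFun o := Sum.elim (fun _ => 1) (fun p => FreeMonoid.of p.1 * p.2) o
  invFun w := match FreeMonoid.toList w with
    | [] => Sum.inl ()
    | i :: l => Sum.inr (i, FreeMonoid.ofList l)
  left_inv o := by rcases o with _ | ⟨i, w⟩ <;> rfl
  right_inv w := by
    induction w using FreeMonoid.inductionOn' with
    | one => rfl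
    | of_mul i w _ => rfl

theorem tsum_word (g : FreeMonoid (Fin n) → ENNReal) :
    ∑' w, g w = g 1 + ∑ i, ∑' w, g (FreeMonoid.of i * w) := by
  have h := (ENNReal.tsum_prod (f := fun (i : Fin n) (w : FreeMonoid (Fin n)) =>
    g (FreeMonoid.of i * w))).trans (tsum_fintype _)
  rw [← h, ← (wordEquiv n).tsum_eq, Summable.tsum_sum ENNReal.summable ENNReal.summable,
    tsum_fintype]
  simp [wordEquiv]

/-- The squared norm of the `w` coordinate of the Poisson kernel. -/
def poissonTerm (T : Fin n → H →L[ℂ] H) (h : H) (w : FreeMonoid (Fin n)) : ENNReal :=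
  ‖defect T (ContinuousLinearMap.adjoint (wordOp T w) h)‖ₑ ^ 2

theorem poissonTerm_one (T : Fin n → H →L[ℂ] H) (h : H) :
    poissonTerm T h 1 = ‖defect T h‖ₑ ^ 2 := by
  have : wordOp T 1 = 1 := by simp [wordOp]
  simp [poissonTerm, this, ← ContinuousLinearMap.star_eq_adjoint]

theorem adjoint_wordOp_of_mul (T : Fin n → H →L[ℂ] H) (h : H) (i : Fin n)
    (w : FreeMonoid (Fin n)) : ContinuousLinearMap.adjoint (wordOp T (FreeMonoid.of i * w)) h
      = ContinuousLinearMap.adjoint (wordOp T w) (ContinuousLinearMap.adjoint (T i) h) := by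
  rw [wordOp_of_mul, ← ContinuousLinearMap.star_eq_adjoint, star_mul]
  rfl

theorem poissonTerm_of_mul (T : Fin n → H →L[ℂ] H) (h : H) (i : Fin n)
    (w : FreeMonoid (Fin n)) : poissonTerm T h (FreeMonoid.of i * w)
      = poissonTerm T (ContinuousLinearMap.adjoint (T i) h) w := by
  rw [poissonTerm, poissonTerm, adjoint_wordOp_of_mul]

theorem enorm_defect_sq {T : Fin n → H →L[ℂ] H} (hT : IsMulticontraction T) (h : H) :
    ‖defect T h‖ₑ ^ 2 + ∑ i, ‖ContinuousLinearMap.adjoint (T i) h‖ₑ ^ 2 = ‖h‖ₑ ^ 2 := by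
  have h1 := congrArg ENNReal.ofReal (norm_defect_sq hT h)
  rw [ENNReal.ofReal_add (by positivity) (by positivity),
    ENNReal.ofReal_sum_of_nonneg (fun i _ => by positivity)] at h1
  simpa [ENNReal.ofReal_pow, ofReal_norm] using h1

theorem tsum_poissonTerm_le {T : Fin n → H →L[ℂ] H} (hT : IsMulticontraction T) (h : H) :
    ∑' w, poissonTerm T h w ≤ ‖h‖ₑ ^ 2 := by
  classical
  have key : ∀ (N : ℕ) (h : H),
      ∑' w, (if w.length < N then poissonTerm T h w else 0) ≤ ‖h‖ₑ ^ 2 := by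
    intro N
    induction N with
    | zero => intro h; simp
    | succ N ih =>
      intro h
      rw [tsum_word, ← enorm_defect_sq hT h]
      refine add_le_add (by simp [poissonTerm_one]) (Finset.sum_le_sum fun i _ => ?_)
      refine le_trans (le_of_eq (tsum_congr fun w => ?_))
        (ih (ContinuousLinearMap.adjoint (T i) h))
      have : (FreeMonoid.of i * w).length < N + 1 ↔ w.length < N := by
        simp only [FreeMonoid.length_mul, FreeMonoid.length_of]; omega
      rw [poissonTerm_of_mul, if_congr this rfl rfl]
  rw [ENNReal.tsum_eq_iSup_sum]
  refine iSup_le fun s => ?_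
  refine le_trans ?_ (key (s.sup FreeMonoid.length + 1) h)
  refine le_trans (Finset.sum_le_sum fun w hw => ?_) (ENNReal.sum_le_tsum s)
  rw [if_pos (Nat.lt_succ_of_le (Finset.le_sup (f := FreeMonoid.length) hw))]

theorem tsum_poissonTerm_eq {T : Fin n → H →L[ℂ] H} (hT : IsMulticontraction T) {c : ℝ}
    (hc0 : 0 ≤ c) (hc1 : c < 1)
    (hc : ∀ h, ∑ i, ‖ContinuousLinearMap.adjoint (T i) h‖ ^ 2 ≤ c * ‖h‖ ^ 2) (h : H) :
    ∑' w, poissonTerm T h w = ‖h‖ₑ ^ 2 := by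
  refine le_antisymm (tsum_poissonTerm_le hT h) ?_
  have key : ∀ (N : ℕ) (h : H),
      ‖h‖ₑ ^ 2 ≤ ∑' w, poissonTerm T h w + ENNReal.ofReal (c ^ N * ‖h‖ ^ 2) := by
    intro N
    induction N with
    | zero => intro h; simp [ENNReal.ofReal_pow, ofReal_norm]
    | succ N ih =>
      intro h
      rw [tsum_word, ← enorm_defect_sq hT h, poissonTerm_one, add_assoc]
      simp only [poissonTerm_of_mul]
      gcongr
      refine (Finset.sum_le_sum fun i _ => ih (ContinuousLinearMap.adjoint (T i) h)).trans ?_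
      rw [Finset.sum_add_distrib]
      gcongr
      rw [← ENNReal.ofReal_sum_of_nonneg (fun i _ => by positivity), ← Finset.mul_sum]
      refine ENNReal.ofReal_le_ofReal ?_
      rw [pow_succ, mul_assoc]
      exact mul_le_mul_of_nonneg_left (hc h) (by positivity)
  have hlim : Filter.Tendsto (fun N : ℕ => ∑' w, poissonTerm T h w
      + ENNReal.ofReal (c ^ N * ‖h‖ ^ 2)) Filter.atTop
      (nhds (∑' w, poissonTerm T h w + ENNReal.ofReal (0 * ‖h‖ ^ 2))) :=
    tendsto_const_nhds.add (ENNReal.tendsto_ofReal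
      ((tendsto_pow_atTop_nhds_zero_of_lt_one hc0 hc1).mul_const _))
  rw [zero_mul, ENNReal.ofReal_zero, add_zero] at hlim
  exact ge_of_tendsto' hlim fun N => key N h

/-- A coordinate of the Poisson kernel, as an element of the Fock space. -/
def poissonCoord (T : Fin n → H →L[ℂ] H) (hT : IsMulticontraction T) (b h : H) : Fock n :=
  ⟨fun w => inner ℂ b (defect T (ContinuousLinearMap.adjoint (wordOp T w) h)), by
    refine (memℓp_gen_iff (by norm_num)).2 ?_
    have h1 : ∑' w, poissonTerm T h w ≠ ⊤ :=
      ne_top_of_le_ne_top (by simp) (tsum_poissonTerm_le hT h)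
    have h2 := (ENNReal.summable_toReal h1).mul_left (‖b‖ ^ 2)
    refine Summable.of_nonneg_of_le (fun w => by positivity) (fun w => ?_) h2
    simp only [poissonTerm, ENNReal.toReal_ofNat, Real.rpow_ofNat, ENNReal.toReal_pow, toReal_enorm,
      ← mul_pow]
    gcongr
    exact norm_inner_le_norm _ _⟩

theorem poissonCoord_apply (T : Fin n → H →L[ℂ] H) (hT : IsMulticontraction T) (b h : H)
    (w : FreeMonoid (Fin n)) : poissonCoord T hT b h w
      = inner ℂ b (defect T (ContinuousLinearMap.adjoint (wordOp T w) h)) := rfl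

theorem adjoint_lift_poissonCoord (T : Fin n → H →L[ℂ] H) (hT : IsMulticontraction T) (b : H)
    (p : FreeAlgebra ℂ (Fin n)) (h : H) :
    ContinuousLinearMap.adjoint (FreeAlgebra.lift ℂ (creation (n := n)) p) (poissonCoord T hT b h)
      = poissonCoord T hT b (ContinuousLinearMap.adjoint (FreeAlgebra.lift ℂ T p) h) := by
  induction p using FreeAlgebra.induction generalizing h with
  | grade0 r =>
    ext w
    simp [Algebra.algebraMap_eq_smul_one, poissonCoord_apply,
      ← ContinuousLinearMap.star_eq_adjoint]
  | grade1 i =>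
    ext w
    rw [← inner_basisVec_left, ContinuousLinearMap.adjoint_inner_right]
    simp only [FreeAlgebra.lift_ι_apply]
    rw [creation_basisVec, inner_basisVec_left, poissonCoord_apply, poissonCoord_apply,
      adjoint_wordOp_of_mul]
  | mul p q hp hq =>
    simp only [map_mul, ← ContinuousLinearMap.star_eq_adjoint, star_mul, mul_apply_eq_comp]
    simp only [ContinuousLinearMap.star_eq_adjoint, hp, hq]
  | add p q hp hq =>
    simp only [map_add, _root_.add_apply, hp, hq]
    ext w
    simp [poissonCoord_apply]

theorem von_neumann_aux {T : Fin n → H →L[ℂ] H} (hT : IsMulticontraction T) {c : ℝ}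
    (hc0 : 0 ≤ c) (hc1 : c < 1)
    (hc : ∀ h, ∑ i, ‖ContinuousLinearMap.adjoint (T i) h‖ ^ 2 ≤ c * ‖h‖ ^ 2)
    (p : FreeAlgebra ℂ (Fin n)) :
    ‖FreeAlgebra.lift ℂ T p‖ ≤ ‖FreeAlgebra.lift ℂ (creation (n := n)) p‖ := by
  obtain ⟨S, b, -⟩ := exists_hilbertBasis ℂ H
  have hsum : ∀ h : H, ‖h‖ₑ ^ 2 = ∑' s, ‖poissonCoord T hT (b s) h‖ₑ ^ 2 := by
    intro h
    rw [← tsum_poissonTerm_eq hT hc0 hc1 hc h]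
    simp only [enorm_sq_lp, poissonCoord_apply]
    rw [ENNReal.tsum_comm]
    refine tsum_congr fun w => ?_
    have h1 := enorm_sq_lp (b.repr (defect T (ContinuousLinearMap.adjoint (wordOp T w) h)))
    simp only [b.repr_apply_apply] at h1
    rw [← h1, poissonTerm, LinearIsometryEquiv.enorm_map]
  rw [← LinearIsometryEquiv.norm_map ContinuousLinearMap.adjoint (FreeAlgebra.lift ℂ T p),
    ← LinearIsometryEquiv.norm_map ContinuousLinearMap.adjoint
      (FreeAlgebra.lift ℂ (creation (n := n)) p)]
  refine ContinuousLinearMap.opNorm_le_bound _ (norm_nonneg _) fun h => ?_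
  have h1 : ‖ContinuousLinearMap.adjoint (FreeAlgebra.lift ℂ T p) h‖ₑ ^ 2
      ≤ (‖ContinuousLinearMap.adjoint (FreeAlgebra.lift ℂ (creation (n := n)) p)‖ₑ * ‖h‖ₑ) ^ 2 := by
    rw [mul_pow, hsum, hsum h, ← ENNReal.tsum_mul_left]
    refine ENNReal.tsum_le_tsum fun s => ?_
    rw [← adjoint_lift_poissonCoord, ← mul_pow]
    gcongr
    exact ContinuousLinearMap.le_opENorm _ _
  have h2 := (ENNReal.pow_le_pow_left_iff (by norm_num)).1 h1
  rw [← ofReal_norm, ← ofReal_norm, ← ofReal_norm,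
    ← ENNReal.ofReal_mul (norm_nonneg _)] at h2
  exact (ENNReal.ofReal_le_ofReal_iff (by positivity)).1 h2

theorem continuous_lift_smul (T : Fin n → H →L[ℂ] H) (p : FreeAlgebra ℂ (Fin n)) :
    Continuous fun r : ℝ => FreeAlgebra.lift ℂ (fun i => (r : ℂ) • T i) p := by
  induction p using FreeAlgebra.induction with
  | grade0 r => simpa using continuous_const
  | grade1 i => simp only [FreeAlgebra.lift_ι_apply]; fun_prop
  | mul p q hp hq => 
    simp only [map_mul]
    exact hp.mul hq
  | add p q hp hq => 
    simp only [map_add]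
    exact hp.add hq

/-- The von Neumann inequality for multicontractions. -/
theorem von_neumann {T : Fin n → H →L[ℂ] H} (hT : IsMulticontraction T)
    (p : FreeAlgebra ℂ (Fin n)) :
    ‖FreeAlgebra.lift ℂ T p‖ ≤ ‖FreeAlgebra.lift ℂ (creation (n := n)) p‖ := by
  have h1 : Filter.Tendsto (fun r : ℝ => ‖FreeAlgebra.lift ℂ (fun i => (r : ℂ) • T i) p‖)
      (nhdsWithin 1 (Set.Ioo 0 1)) (nhds ‖FreeAlgebra.lift ℂ T p‖) := by
    have := ((continuous_lift_smul T p).norm.tendsto 1).mono_left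
      (nhdsWithin_le_nhds (s := Set.Ioo 0 1))
    simpa using this
  have hne : (nhdsWithin (1 : ℝ) (Set.Ioo 0 1)).NeBot := by
    rw [nhdsWithin_Ioo_eq_nhdsLT one_pos]; infer_instance
  refine le_of_tendsto h1 ?_
  filter_upwards [self_mem_nhdsWithin] with r hr
  have e : ∑ i, ((r : ℂ) • T i) * ContinuousLinearMap.adjoint ((r : ℂ) • T i)
      = ((r ^ 2 : ℝ) : ℂ) • ∑ i, T i * ContinuousLinearMap.adjoint (T i) := by
    rw [Finset.smul_sum]
    refine Finset.sum_congr rfl fun i _ => ?_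
    rw [map_smulₛₗ, smul_mul_smul_comm]
    simp [pow_two]
  have hc : ∀ h, ∑ i, ‖ContinuousLinearMap.adjoint ((r : ℂ) • T i) h‖ ^ 2 ≤ r ^ 2 * ‖h‖ ^ 2 := by
    intro h
    simp only [map_smulₛₗ, _root_.smul_apply, norm_smul, mul_pow, ← Finset.mul_sum]
    simp only [RCLike.norm_conj, Complex.norm_real, Real.norm_eq_abs, sq_abs]
    exact mul_le_mul_of_nonneg_left (sum_norm_adjoint_sq_le hT h) (by positivity)
  have hr1 : r ^ 2 < 1 := by nlinarith [hr.1, hr.2]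
  refine von_neumann_aux (T := fun i => (r : ℂ) • T i) ?_ (sq_nonneg r) hr1 hc p
  rw [IsMulticontraction, e, ContinuousLinearMap.le_def]
  have e2 : (1 : H →L[ℂ] H) - ((r ^ 2 : ℝ) : ℂ) • ∑ i, T i * ContinuousLinearMap.adjoint (T i)
      = ((r ^ 2 : ℝ) : ℂ) • (1 - ∑ i, T i * ContinuousLinearMap.adjoint (T i))
        + ((1 - r ^ 2 : ℝ) : ℂ) • 1 := by
    push_cast
    module
  rw [e2]
  open scoped ComplexOrder in
  exact (((ContinuousLinearMap.le_def _ _).1 hT).smul_of_nonneg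
    (by exact_mod_cast sq_nonneg r)).add (ContinuousLinearMap.isPositive_one.smul_of_nonneg
      (by rw [Complex.zero_le_real]; linarith))

/-- The closure of the set of all pairs `(p(L), p(T))`, for `p` a noncommutative polynomial. -/
def calculusGraph (T : Fin n → H →L[ℂ] H) :
    Subalgebra ℂ ((Fock n →L[ℂ] Fock n) × (H →L[ℂ] H)) :=
  (((FreeAlgebra.lift ℂ (creation (n := n))).prod (FreeAlgebra.lift ℂ T)).range).topologicalClosure

theorem norm_snd_le {T : Fin n → H →L[ℂ] H} (hT : IsMulticontraction T)
    {a : (Fock n →L[ℂ] Fock n) × (H →L[ℂ] H)} (ha : a ∈ calculusGraph T) : ‖a.2‖ ≤ ‖a.1‖ := by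
  have hcl : IsClosed {a : (Fock n →L[ℂ] Fock n) × (H →L[ℂ] H) | ‖a.2‖ ≤ ‖a.1‖} :=
    isClosed_le (by fun_prop) (by fun_prop)
  refine closure_minimal ?_ hcl ha
  rintro _ ⟨p, rfl⟩
  exact von_neumann hT p

theorem fst_mem_disc {T : Fin n → H →L[ℂ] H}
    {a : (Fock n →L[ℂ] Fock n) × (H →L[ℂ] H)} (ha : a ∈ calculusGraph T) :
    a.1 ∈ discAlgebra n := by
  refine map_mem_closure (f := Prod.fst) continuous_fst ha ?_
  rintro _ ⟨p, rfl⟩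
  rw [Algebra.adjoin_range_eq_range_freeAlgebra_lift]
  exact ⟨p, rfl⟩

/-- The first projection of the graph of the functional calculus. -/
def graphFst (T : Fin n → H →L[ℂ] H) : calculusGraph T →ₐ[ℂ] discAlgebra n :=
  ((AlgHom.fst ℂ _ _).comp (calculusGraph T).val).codRestrict (discAlgebra n)
    fun a => fst_mem_disc a.2

theorem graphFst_bijective {T : Fin n → H →L[ℂ] H} (hT : IsMulticontraction T) :
    Function.Bijective (graphFst T) := by
  have hiso : Isometry (graphFst T) := by
    refine AddMonoidHomClass.isometry_of_norm (graphFst T) fun a => ?_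
    have h1 : ‖a‖ = max ‖a.1.1‖ ‖a.1.2‖ := rfl
    refine Eq.trans ?_ (h1.trans (max_eq_left (norm_snd_le hT a.2))).symm
    rfl
  refine ⟨hiso.injective, ?_⟩
  have hcg : IsClosed (calculusGraph T : Set ((Fock n →L[ℂ] Fock n) × (H →L[ℂ] H))) :=
    Subalgebra.isClosed_topologicalClosure _
  have : CompleteSpace (calculusGraph T) := hcg.completeSpace_coe
  have hcl : IsClosed (Set.range (graphFst T)) := hiso.isClosedEmbedding.isClosed_range
  have hcl2 : IsClosed (Subtype.val '' Set.range (graphFst T)) :=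
    isClosed_discAlgebra.isClosedEmbedding_subtypeVal.isClosedMap _ hcl
  rintro ⟨a, ha⟩
  have : a ∈ Subtype.val '' Set.range (graphFst T) := by
    refine closure_minimal ?_ hcl2 ha
    intro c hc
    rw [Algebra.adjoin_range_eq_range_freeAlgebra_lift] at hc
    obtain ⟨p, rfl⟩ := hc
    exact ⟨_, ⟨⟨(FreeAlgebra.lift ℂ creation p, FreeAlgebra.lift ℂ T p),
      Subalgebra.le_topologicalClosure _ ⟨p, rfl⟩⟩, rfl⟩, rfl⟩
  obtain ⟨_, ⟨c, rfl⟩, hc⟩ := this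
  exact ⟨c, Subtype.ext hc⟩

/-- The `𝔩_n`-functional calculus `ρ : 𝔩_n → 𝓛(H)` of a multicontraction: the (unique)
contractive unital homomorphism with `ρ(L_i) = T_i`. -/
def calculus (T : Fin n → H →L[ℂ] H) (hT : IsMulticontraction T) :
    discAlgebra n →ₐ[ℂ] (H →L[ℂ] H) :=
  ((AlgHom.snd ℂ (Fock n →L[ℂ] Fock n) (H →L[ℂ] H)).comp (calculusGraph T).val).comp
    (AlgEquiv.ofBijective (graphFst T) (graphFst_bijective hT)).symm.toAlgHom

theorem norm_calculus_le (T : Fin n → H →L[ℂ] H) (hT : IsMulticontraction T)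
    (f : discAlgebra n) : ‖calculus T hT f‖ ≤ ‖f‖ := by
  obtain ⟨a, rfl⟩ := (AlgEquiv.ofBijective (graphFst T) (graphFst_bijective hT)).surjective f
  have h : calculus T hT (AlgEquiv.ofBijective (graphFst T) (graphFst_bijective hT) a) = a.1.2 :=
    congrArg (fun c : calculusGraph T => c.1.2) 
      ((AlgEquiv.ofBijective (graphFst T) (graphFst_bijective hT)).symm_apply_apply a)
  rw [h]
  exact norm_snd_le hT a.2

theorem calculus_genDisc (T : Fin n → H →L[ℂ] H) (hT : IsMulticontraction T) (i : Fin n) :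
    calculus T hT (genDisc i) = T i := by
  have h : (AlgEquiv.ofBijective (graphFst T) (graphFst_bijective hT)).symm (genDisc i)
      = ⟨(creation i, T i), Subalgebra.le_topologicalClosure _
        ⟨FreeAlgebra.ι ℂ i, by simp⟩⟩ := by
    rw [AlgEquiv.symm_apply_eq]
    rfl
  exact congrArg (fun c : calculusGraph T => c.1.2) h

theorem calculus_unique (T : Fin n → H →L[ℂ] H) (hT : IsMulticontraction T)
    (σ : discAlgebra n →ₐ[ℂ] (H →L[ℂ] H)) (hσ : Continuous σ) (h : ∀ i, σ (genDisc i) = T i) :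
    σ = calculus T hT := by
  have hc : Continuous (calculus T hT) :=
    AddMonoidHomClass.continuous_of_bound (calculus T hT) 1
      fun f => by rw [one_mul]; exact norm_calculus_le T hT f
  have hle : Algebra.adjoin ℂ (Set.range (creation (n := n))) ≤ discAlgebra n :=
    Subalgebra.le_topologicalClosure _
  have heq : σ.comp (Subalgebra.inclusion hle) = (calculus T hT).comp (Subalgebra.inclusion hle) := by
    refine AlgHom.adjoin_ext ?_
    rintro _ ⟨i, rfl⟩
    exact (h i).trans (calculus_genDisc T hT i).symm
  refine AlgHom.ext fun f => ?_
  have hd : DenseRange (Subalgebra.inclusion hle) := by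
    intro f
    rw [closure_subtype]
    refine closure_mono ?_ f.2
    intro a ha
    exact ⟨⟨a, hle ha⟩, ⟨⟨a, ha⟩, rfl⟩, rfl⟩
  refine congrFun (hd.equalizer hσ hc ?_) f
  funext a
  exact congrArg (fun τ => τ a) heq

end Calculus

section Constraints

variable {n : ℕ} {H : Type*} [NormedAddCommGroup H] [InnerProductSpace ℂ H] [CompleteSpace H]

/-- The multioperator `Φ_X⁻¹(T) = ρ(Φ_X⁻¹(L))`, where `ρ` is the functional calculus of `T`. -/
def transformInv (X : U1 n) (T : Fin n → H →L[ℂ] H) (hT : IsMulticontraction T) :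
    Fin n → H →L[ℂ] H :=
  fun i => calculus T hT ((autDisc X).symm (genDisc i))

/-- `T` is completely noncoisometric: no nonzero `h` satisfies `∑_{|w|=k} ‖T_w* h‖² = ‖h‖²` for
all `k`. -/
def IsCNC (T : Fin n → H →L[ℂ] H) : Prop :=
  ∀ h : H, (∀ k : ℕ, ∑ v : Fin k → Fin n,
    ‖ContinuousLinearMap.adjoint (wordOp T (FreeMonoid.ofList (List.ofFn v))) h‖ ^ 2 = ‖h‖ ^ 2) →
      h = 0

/-- The Fourier coefficient `f̂_w` of `f = ∑ f̂_w L_w`, that is, the coefficient of `e_w` in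
`f e_∅`. -/
def fourierCoeff (f : Fock n →L[ℂ] Fock n) (w : FreeMonoid (Fin n)) : ℂ :=
  f (basisVec 1) w

/-- `f_r(T) = ∑_w f̂_w r^{|w|} T_w`. -/
def radialEval (T : Fin n → H →L[ℂ] H) (f : Fock n →L[ℂ] Fock n) (r : ℝ) : H →L[ℂ] H :=
  ∑' w : FreeMonoid (Fin n), (fourierCoeff f w * (r : ℂ) ^ w.length) • wordOp T w

/-- `f(T) = B` in the extended functional calculus: `B` is the limit of `f_r(T)` in the strong
operator topology as `r` increases to `1`. -/
def HasToeplitzValue (T : Fin n → H →L[ℂ] H) (f : Fock n →L[ℂ] Fock n) (B : H →L[ℂ] H) : Prop :=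
  ∀ h : H, Filter.Tendsto (fun r : ℝ => radialEval T f r h) (nhdsWithin 1 (Set.Iio 1)) (nhds (B h))

/-- `T` is a `𝔧`-constrained multicontraction, for an ideal `𝔧` of `𝔩_n`. -/
def IsDiscConstrained (T : Fin n → H →L[ℂ] H) (j : TwoSidedIdeal (discAlgebra n)) : Prop :=
  ∃ hT : IsMulticontraction T, ∀ f ∈ j, calculus T hT f = 0

/-- `T` is a `𝔍`-constrained completely noncoisometric multicontraction, for an ideal `𝔍` of
`𝔏_n`. -/
def IsToeplitzConstrained (T : Fin n → H →L[ℂ] H) (J : TwoSidedIdeal (toeplitzAlgebra n)) : Prop :=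
  IsMulticontraction T ∧ IsCNC T ∧ ∀ f ∈ J, HasToeplitzValue T (f : Fock n →L[ℂ] Fock n) 0

/-- The ideal `𝔍` of `𝔏_n` is closed in the weak operator topology of `𝓛(𝔉_n)`. -/
def IsWOTClosed (J : TwoSidedIdeal (toeplitzAlgebra n)) : Prop :=
  IsClosed ((fun f : toeplitzAlgebra n =>
    ContinuousLinearMapWOT.ofCLM (f : Fock n →L[ℂ] Fock n)) '' (J : Set (toeplitzAlgebra n)))

/-- The ideal `Φ_X(𝔧)` of `𝔩_n`. -/
def mapDisc (X : U1 n) (j : TwoSidedIdeal (discAlgebra n)) : TwoSidedIdeal (discAlgebra n) :=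
  (autDisc X).toRingEquiv.mapTwoSidedIdeal j

/-- The ideal `Φ_X(𝔍)` of `𝔏_n`. -/
def mapToeplitz (X : U1 n) (J : TwoSidedIdeal (toeplitzAlgebra n)) :
    TwoSidedIdeal (toeplitzAlgebra n) :=
  (autToeplitz X).toRingEquiv.mapTwoSidedIdeal J

theorem coe_mapDisc (X : U1 n) (j : TwoSidedIdeal (discAlgebra n)) :
    (mapDisc X j : Set (discAlgebra n)) = autDisc X '' j := by
  ext f
  rw [mapDisc, RingEquiv.mapTwoSidedIdeal_apply, SetLike.mem_coe, TwoSidedIdeal.mem_comap]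
  exact ⟨fun h => ⟨_, h, (autDisc X).apply_symm_apply f⟩, by
    rintro ⟨g, hg, rfl⟩
    exact (congrArg (· ∈ j) ((autDisc X).symm_apply_apply g)).mpr hg⟩

theorem coe_mapToeplitz (X : U1 n) (J : TwoSidedIdeal (toeplitzAlgebra n)) :
    (mapToeplitz X J : Set (toeplitzAlgebra n)) = autToeplitz X '' J := by
  ext f
  rw [mapToeplitz, RingEquiv.mapTwoSidedIdeal_apply, SetLike.mem_coe, TwoSidedIdeal.mem_comap]
  exact ⟨fun h => ⟨_, h, (autToeplitz X).apply_symm_apply f⟩, by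
    rintro ⟨g, hg, rfl⟩
    exact (congrArg (· ∈ J) ((autToeplitz X).symm_apply_apply g)).mpr hg⟩

end Constraints

end RowContraction

end

open RowContraction

/-! Write `S` for `transformInv X T hT`, the tuple Φ_X⁻¹(T). The proof compares the Poisson kernels
of `S` and `T`. The coordinate of the Poisson kernel along `b` has the adjoint `poissonAdjoint T hT
b`, sending e_w to T_w D_T b, where D_T is the defect operator of T. It intertwines f with f(T) for
every f in 𝔩_n (`poissonAdjoint_disc`).

Let M = (x' - T[z'])⁻¹, where x', z' belong to X⁻¹ = J X* J. Taking adjoints shows that M*⁻¹h and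
the vectors S_i* M*⁻¹h are the rows of X applied to the column (h, T_1* h, …, T_n* h). As X
preserves J, it follows that 1 - ∑ S_i S_i* = M (1 - ∑ T_i T_i*) M* (`inner_transformInv`,
`defect_sq_transformInv`), so S is a row contraction. By uniqueness of the functional calculus ρ_S =
ρ_T ∘ Φ_X⁻¹, which gives the first part.

For the second part, S_w D_S² b = ρ_T(Φ_X⁻¹(L_w)) M D_T² M* b. Intertwining moves the operators
ρ_T(Φ_X⁻¹(L_w)) and M to the Fock space, where they turn e_∅ into U_X* e_w. Hence the Poisson kernel
of S is that of T composed with the unitary U_X* (`poissonAdjoint_transformInv`). Being c.n.c. means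
that the Poisson kernel is injective (`isCNC_iff`), so it passes from T to S. The condition f(T) = 0
can also be read off from the kernel: it implies that every `poissonAdjoint` annihilates the range
of f (`poissonAdjoint_comp_eq_zero`), and the converse holds for c.n.c. tuples
(`hasToeplitzValue_zero`), since the ranges of the `poissonAdjoint` then span a dense subspace and
‖f_r(T)‖ ≤ ‖f‖. Since U_X* Φ_X(f) = f U_X*, the constraint is transported as well. -/

noncomputable section

namespace RowContraction

open ContinuousLinearMap (adjoint)
open Filter Topology

/-! ### Sums over words, the c.n.c. condition and convergence of f_r(T) -/

section WordSums

variable {n : ℕ} {H : Type*} [NormedAddCommGroup H] [InnerProductSpace ℂ H]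

theorem wordOp_one (T : Fin n → H →L[ℂ] H) : wordOp T 1 = 1 := by simp [wordOp]

theorem wordOp_mul (T : Fin n → H →L[ℂ] H) (v w : FreeMonoid (Fin n)) :
    wordOp T (v * w) = wordOp T v * wordOp T w := by simp [wordOp]

theorem wordOp_smul (T : Fin n → H →L[ℂ] H) (c : ℂ) (w : FreeMonoid (Fin n)) :
    wordOp (fun i => c • T i) w = c ^ w.length • wordOp T w := by
  induction w using FreeMonoid.inductionOn' with
  | one => simp [wordOp_one]
  | of_mul i w ih =>
    rw [wordOp_of_mul, wordOp_of_mul, ih, smul_mul_smul_comm, FreeMonoid.length_mul,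
      FreeMonoid.length_of, pow_add, pow_one]

theorem sum_words_succ (k : ℕ) (g : FreeMonoid (Fin n) → ℝ) :
    ∑ v : Fin (k + 1) → Fin n, g (FreeMonoid.ofList (List.ofFn v))
      = ∑ i, ∑ v : Fin k → Fin n, g (FreeMonoid.of i * FreeMonoid.ofList (List.ofFn v)) := by
  rw [← (Fin.consEquiv fun _ : Fin (k + 1) => Fin n).sum_comp, Fintype.sum_prod_type]
  refine Finset.sum_congr rfl fun i _ => Finset.sum_congr rfl fun v _ => ?_
  simp [Fin.consEquiv, List.ofFn_succ, FreeMonoid.ofList_cons]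

variable [CompleteSpace H]

/-- The identity ‖D h‖² + ∑ ‖T_i* h‖² = ‖h‖² is applied at every word of length k. The defect terms
of length k are thus exactly the loss from the level k to the level k + 1. -/
theorem sum_words_defect {T : Fin n → H →L[ℂ] H} (hT : IsMulticontraction T) (k : ℕ) (h : H) :
    ∑ v : Fin k → Fin n,
        ‖defect T (adjoint (wordOp T (FreeMonoid.ofList (List.ofFn v))) h)‖ ^ 2
      + ∑ v : Fin (k + 1) → Fin n,
        ‖adjoint (wordOp T (FreeMonoid.ofList (List.ofFn v))) h‖ ^ 2
      = ∑ v : Fin k → Fin n, ‖adjoint (wordOp T (FreeMonoid.ofList (List.ofFn v))) h‖ ^ 2 := by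
  induction k generalizing h with
  | zero =>
    have h1 : adjoint (1 : H →L[ℂ] H) = 1 := by simp [← ContinuousLinearMap.star_eq_adjoint]
    rw [sum_words_succ 0 fun w => ‖adjoint (wordOp T w) h‖ ^ 2]
    simpa [wordOp_one, wordOp_mul, h1, wordOp] using norm_defect_sq hT h
  | succ k ih =>
    rw [sum_words_succ k fun w => ‖defect T (adjoint (wordOp T w) h)‖ ^ 2,
      sum_words_succ (k + 1) fun w => ‖adjoint (wordOp T w) h‖ ^ 2,
      sum_words_succ k fun w => ‖adjoint (wordOp T w) h‖ ^ 2, ← Finset.sum_add_distrib]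
    simp only [adjoint_wordOp_of_mul]
    exact Finset.sum_congr rfl fun i _ => ih _

/-- The level sums are constant in k precisely when every loss in `sum_words_defect` is zero. This
turns c.n.c. into injectivity of the Poisson kernel, the form used from here on. -/
theorem isCNC_iff {T : Fin n → H →L[ℂ] H} (hT : IsMulticontraction T) :
    IsCNC T ↔ ∀ h : H, (∀ w, defect T (adjoint (wordOp T w) h) = 0) → h = 0 := by
  have h1 : adjoint (1 : H →L[ℂ] H) = 1 := by simp [← ContinuousLinearMap.star_eq_adjoint]
  refine forall_congr' fun h => imp_congr_left ⟨fun hs w => ?_, fun hd k => ?_⟩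
  · have hk := sum_words_defect hT w.length h
    rw [hs, hs, add_eq_right, Finset.sum_eq_zero_iff_of_nonneg fun _ _ => by positivity] at hk
    have hw : FreeMonoid.ofList (List.ofFn (n := w.length) w.toList.get) = w :=
      List.ofFn_get w.toList
    have := hk w.toList.get (Finset.mem_univ _)
    rwa [hw, sq_eq_zero_iff, norm_eq_zero] at this
  · induction k with
    | zero => simp [wordOp_one, h1]
    | succ k ih => simpa [hd, ih] using sum_words_defect hT k h

/-- The square function of a strict row contraction is bounded. -/
theorem tsum_enorm_adjoint_wordOp_le {T : Fin n → H →L[ℂ] H} {c : ℝ} (hc0 : 0 ≤ c) (hc1 : c < 1)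
    (hc : ∀ h, ∑ i, ‖adjoint (T i) h‖ ^ 2 ≤ c * ‖h‖ ^ 2) (h : H) :
    ∑' w, ‖adjoint (wordOp T w) h‖ₑ ^ 2 ≤ ENNReal.ofReal ((1 - c)⁻¹ * ‖h‖ ^ 2) := by
  classical
  have h1 : adjoint (1 : H →L[ℂ] H) = 1 := by simp [← ContinuousLinearMap.star_eq_adjoint]
  have hc2 : 0 < 1 - c := by linarith
  -- Truncating by length permits induction on N for all h at once; each finite set of words lies
  -- below some N.
  have key : ∀ (N : ℕ) (h : H),
      ∑' w : FreeMonoid (Fin n), (if w.length < N then ‖adjoint (wordOp T w) h‖ₑ ^ 2 else 0)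
        ≤ ENNReal.ofReal ((1 - c)⁻¹ * ‖h‖ ^ 2) := by
    intro N
    induction N with
    | zero => intro h; simp
    | succ N ih =>
      intro h
      -- The constant is the sum of the geometric series of c: the empty word contributes ‖h‖², and
      -- one letter costs a factor c.
      have e : (1 - c)⁻¹ * ‖h‖ ^ 2 = ‖h‖ ^ 2 + (1 - c)⁻¹ * (c * ‖h‖ ^ 2) := by
        field_simp; ring
      rw [tsum_word, e, ENNReal.ofReal_add (by positivity) (by positivity)]
      refine add_le_add (by simp [wordOp_one, h1, ENNReal.ofReal_pow, ofReal_norm]) ?_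
      calc _ ≤ ∑ i, ENNReal.ofReal ((1 - c)⁻¹ * ‖adjoint (T i) h‖ ^ 2) := by
            refine Finset.sum_le_sum fun i _ => ?_
            refine le_trans (le_of_eq (tsum_congr fun w => ?_)) (ih (adjoint (T i) h))
            have : (FreeMonoid.of i * w).length < N + 1 ↔ w.length < N := by
              simp only [FreeMonoid.length_mul, FreeMonoid.length_of]; omega
            rw [adjoint_wordOp_of_mul, if_congr this rfl rfl]
        _ ≤ _ := by
            rw [← ENNReal.ofReal_sum_of_nonneg fun i _ => by positivity, ← Finset.mul_sum]
            exact ENNReal.ofReal_le_ofReal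
              (mul_le_mul_of_nonneg_left (hc h) (inv_nonneg.2 hc2.le))
  rw [ENNReal.tsum_eq_iSup_sum]
  refine iSup_le fun s => le_trans ?_ (key (s.sup FreeMonoid.length + 1) h)
  refine le_trans (Finset.sum_le_sum fun w hw => ?_) (ENNReal.sum_le_tsum s)
  rw [if_pos (Nat.lt_succ_of_le (Finset.le_sup (f := FreeMonoid.length) hw))]

theorem sum_norm_adjoint_wordOp_le {T : Fin n → H →L[ℂ] H} {c : ℝ} (hc0 : 0 ≤ c) (hc1 : c < 1)
    (hc : ∀ h, ∑ i, ‖adjoint (T i) h‖ ^ 2 ≤ c * ‖h‖ ^ 2) (h : H)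
    (s : Finset (FreeMonoid (Fin n))) :
    ∑ w ∈ s, ‖adjoint (wordOp T w) h‖ ^ 2 ≤ (1 - c)⁻¹ * ‖h‖ ^ 2 := by
  have hc2 : 0 < 1 - c := by linarith
  have := (ENNReal.sum_le_tsum s).trans (tsum_enorm_adjoint_wordOp_le hc0 hc1 hc h)
  rw [← ENNReal.ofReal_le_ofReal_iff (by positivity),
    ENNReal.ofReal_sum_of_nonneg fun _ _ => by positivity]
  simpa [ENNReal.ofReal_pow, ofReal_norm] using this

/-- Partial sums of `∑ ξ_w T_w` are controlled by the `ℓ²` norm of the coefficients. -/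
theorem norm_sum_smul_wordOp_le {T : Fin n → H →L[ℂ] H} {c : ℝ} (hc0 : 0 ≤ c) (hc1 : c < 1)
    (hc : ∀ h, ∑ i, ‖adjoint (T i) h‖ ^ 2 ≤ c * ‖h‖ ^ 2) (ξ : FreeMonoid (Fin n) → ℂ)
    (s : Finset (FreeMonoid (Fin n))) :
    ‖∑ w ∈ s, ξ w • wordOp T w‖
      ≤ √(1 - c)⁻¹ * √(∑ w ∈ s, ‖ξ w‖ ^ 2) := by
  have hc2 : 0 < 1 - c := by linarith
  -- The square function controls the adjoints T_w*, so Cauchy–Schwarz is applied to the adjoint of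
  -- the sum.
  rw [← LinearIsometryEquiv.norm_map adjoint]
  refine ContinuousLinearMap.opNorm_le_bound _ (by positivity) fun h => ?_
  simp only [map_sum, map_smulₛₗ, _root_.sum_apply, _root_.smul_apply]
  calc _ ≤ ∑ w ∈ s, ‖ξ w‖ * ‖adjoint (wordOp T w) h‖ := by
        refine (norm_sum_le _ _).trans (Finset.sum_le_sum fun w _ => ?_)
        rw [norm_smul, RCLike.norm_conj]
    _ ≤ √(∑ w ∈ s, ‖ξ w‖ ^ 2) * √(∑ w ∈ s, ‖adjoint (wordOp T w) h‖ ^ 2) :=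
        Real.sum_mul_le_sqrt_mul_sqrt _ _ _
    _ ≤ √(∑ w ∈ s, ‖ξ w‖ ^ 2) * √((1 - c)⁻¹ * ‖h‖ ^ 2) := by
        gcongr
        exact sum_norm_adjoint_wordOp_le hc0 hc1 hc h s
    _ = _ := by
        rw [Real.sqrt_mul (by positivity), Real.sqrt_sq (norm_nonneg _)]
        ring

theorem summable_norm_sq (ξ : Fock n) : Summable fun w => ‖ξ w‖ ^ 2 := by
  have h := lp.hasSum_norm (p := 2) (by norm_num) ξ
  simp only [ENNReal.toReal_ofNat, Real.rpow_ofNat] at h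
  exact h.summable

theorem summable_smul_wordOp {T : Fin n → H →L[ℂ] H} {c : ℝ} (hc0 : 0 ≤ c) (hc1 : c < 1)
    (hc : ∀ h, ∑ i, ‖adjoint (T i) h‖ ^ 2 ≤ c * ‖h‖ ^ 2) (ξ : Fock n) :
    Summable fun w => ξ w • wordOp T w := by
  have hc2 : 0 < 1 - c := by linarith
  rw [summable_iff_vanishing_norm]
  intro ε hε
  -- The factor 1 - c cancels the constant of `norm_sum_smul_wordOp_le`.
  obtain ⟨s, hs⟩ := summable_iff_vanishing_norm.1 (summable_norm_sq ξ) (ε ^ 2 * (1 - c))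
    (by positivity)
  refine ⟨s, fun t ht => (norm_sum_smul_wordOp_le hc0 hc1 hc ξ t).trans_lt ?_⟩
  have h1 := hs t ht
  rw [Real.norm_of_nonneg (by positivity)] at h1
  rw [← Real.sqrt_mul (by positivity), Real.sqrt_lt' hε, inv_mul_lt_iff₀ hc2]
  linarith

theorem sum_norm_adjoint_smul_sq_le {T : Fin n → H →L[ℂ] H} (hT : IsMulticontraction T) (r : ℝ)
    (h : H) : ∑ i, ‖adjoint ((r : ℂ) • T i) h‖ ^ 2 ≤ r ^ 2 * ‖h‖ ^ 2 := by
  simp only [map_smulₛₗ, _root_.smul_apply, norm_smul, mul_pow, ← Finset.mul_sum]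
  simp only [RCLike.norm_conj, Complex.norm_real, Real.norm_eq_abs, sq_abs]
  exact mul_le_mul_of_nonneg_left (sum_norm_adjoint_sq_le hT h) (by positivity)

theorem isMulticontraction_iff {T : Fin n → H →L[ℂ] H} :
    IsMulticontraction T ↔ ∀ h, ∑ i, ‖adjoint (T i) h‖ ^ 2 ≤ ‖h‖ ^ 2 := by
  refine ⟨sum_norm_adjoint_sq_le, fun hT => ?_⟩
  rw [IsMulticontraction, ContinuousLinearMap.le_def, ContinuousLinearMap.isPositive_iff]
  have hsa : IsSelfAdjoint (1 - ∑ i, T i * adjoint (T i)) :=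
    (IsSelfAdjoint.one _).sub (isSelfAdjoint_sum _ fun i _ => IsSelfAdjoint.mul_star_self (T i))
  refine ⟨hsa.isSymmetric, fun h => ?_⟩
  have e : inner ℂ ((1 - ∑ i, T i * adjoint (T i)) h) h
      = ((‖h‖ ^ 2 - ∑ i, ‖adjoint (T i) h‖ ^ 2 : ℝ) : ℂ) := by
    simp only [_root_.sub_apply, one_apply_eq_self, _root_.sum_apply, mul_apply_eq_comp,
      inner_sub_left, sum_inner, ← ContinuousLinearMap.adjoint_inner_right,
      inner_self_eq_norm_sq_to_K]
    push_cast
    rfl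
  open scoped ComplexOrder in
  rw [e, Complex.zero_le_real]
  exact sub_nonneg.2 (hT h)

theorem IsMulticontraction.smul {T : Fin n → H →L[ℂ] H} (hT : IsMulticontraction T) {r : ℝ}
    (hr : r ^ 2 ≤ 1) : IsMulticontraction fun i => (r : ℂ) • T i :=
  isMulticontraction_iff.2 fun h => (sum_norm_adjoint_smul_sq_le hT r h).trans
    (mul_le_of_le_one_left (by positivity) hr)

/-- The series is ∑ f̂_w (rT)_w, and rT is a strict row contraction. Summability makes the `tsum` in
`radialEval` a genuine sum. -/
theorem summable_radialEval {T : Fin n → H →L[ℂ] H} (hT : IsMulticontraction T) {r : ℝ}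
    (hr : r ^ 2 < 1) (f : Fock n →L[ℂ] Fock n) :
    Summable fun w => (fourierCoeff f w * (r : ℂ) ^ w.length) • wordOp T w := by
  have := summable_smul_wordOp (sq_nonneg r) hr (sum_norm_adjoint_smul_sq_le hT r)
    (f (basisVec 1))
  simpa only [wordOp_smul, smul_smul, fourierCoeff] using this

end WordSums

/-! ### The Poisson kernel and its intertwining property -/

section Poisson

variable {n : ℕ} {H : Type*} [NormedAddCommGroup H] [InnerProductSpace ℂ H] [CompleteSpace H]

theorem adjoint_defect (T : Fin n → H →L[ℂ] H) : adjoint (defect T) = defect T :=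
  (CFC.sqrt_nonneg _).isSelfAdjoint

theorem defect_mul_self {T : Fin n → H →L[ℂ] H} (hT : IsMulticontraction T) :
    defect T * defect T = 1 - ∑ i, T i * adjoint (T i) :=
  CFC.sqrt_mul_sqrt_self _ (sub_nonneg.2 hT)

theorem norm_poissonCoord_le {T : Fin n → H →L[ℂ] H} (hT : IsMulticontraction T) (b h : H) :
    ‖poissonCoord T hT b h‖ ≤ ‖b‖ * ‖h‖ := by
  have h1 : ‖poissonCoord T hT b h‖ₑ ^ 2 ≤ (‖b‖ₑ * ‖h‖ₑ) ^ 2 := by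
    rw [enorm_sq_lp, mul_pow]
    refine le_trans ?_ (mul_le_mul_right (tsum_poissonTerm_le hT h) _)
    rw [← ENNReal.tsum_mul_left]
    refine ENNReal.tsum_le_tsum fun w => ?_
    rw [poissonTerm, ← mul_pow, poissonCoord_apply]
    gcongr
    rw [← ofReal_norm, ← ofReal_norm, ← ofReal_norm, ← ENNReal.ofReal_mul (norm_nonneg _)]
    exact ENNReal.ofReal_le_ofReal (norm_inner_le_norm _ _)
  have h2 := (ENNReal.pow_le_pow_left_iff (by norm_num)).1 h1
  rw [← ofReal_norm, ← ofReal_norm, ← ofReal_norm, ← ENNReal.ofReal_mul (norm_nonneg _)] at h2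
  exact (ENNReal.ofReal_le_ofReal_iff (by positivity)).1 h2

/-- A coordinate of the Poisson kernel, as a bounded operator. -/
def poissonMap (T : Fin n → H →L[ℂ] H) (hT : IsMulticontraction T) (b : H) : H →L[ℂ] Fock n :=
  LinearMap.mkContinuous
    { toFun := poissonCoord T hT b
      map_add' := fun h k => by ext w; simp [poissonCoord_apply]
      map_smul' := fun c h => by ext w; simp [poissonCoord_apply] }
    ‖b‖ fun h => norm_poissonCoord_le hT b h

/-- The adjoint of a coordinate of the Poisson kernel, which sends `e_w` to `T_w D_{T*} b`. -/
def poissonAdjoint (T : Fin n → H →L[ℂ] H) (hT : IsMulticontraction T) (b : H) :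
    Fock n →L[ℂ] H := adjoint (poissonMap T hT b)

variable {T : Fin n → H →L[ℂ] H} (hT : IsMulticontraction T)

theorem adjoint_poissonAdjoint (b h : H) :
    adjoint (poissonAdjoint T hT b) h = poissonCoord T hT b h := by
  rw [poissonAdjoint, ContinuousLinearMap.adjoint_adjoint]
  rfl

theorem poissonAdjoint_basisVec (b : H) (w : FreeMonoid (Fin n)) :
    poissonAdjoint T hT b (basisVec w) = wordOp T w (defect T b) := by
  refine ext_inner_left ℂ fun h => ?_
  rw [← ContinuousLinearMap.adjoint_inner_left, adjoint_poissonAdjoint, ← inner_conj_symm,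
    inner_basisVec_left, poissonCoord_apply, inner_conj_symm,
    ← ContinuousLinearMap.adjoint_inner_left, ← ContinuousLinearMap.adjoint_inner_left,
    adjoint_defect]

theorem poissonAdjoint_lift (b : H) (p : FreeAlgebra ℂ (Fin n)) (ξ : Fock n) :
    poissonAdjoint T hT b (FreeAlgebra.lift ℂ (creation (n := n)) p ξ)
      = FreeAlgebra.lift ℂ T p (poissonAdjoint T hT b ξ) := by
  refine ext_inner_left ℂ fun h => ?_
  rw [← ContinuousLinearMap.adjoint_inner_left, adjoint_poissonAdjoint,
    ← ContinuousLinearMap.adjoint_inner_left, adjoint_lift_poissonCoord,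
    ← adjoint_poissonAdjoint, ContinuousLinearMap.adjoint_inner_left,
    ContinuousLinearMap.adjoint_inner_left]

/-- Intertwining is a closed condition on the pair `a`, so it extends from polynomials to the
closure of their graph. -/
theorem poissonAdjoint_of_mem_graph (b : H) {a : (Fock n →L[ℂ] Fock n) × (H →L[ℂ] H)}
    (ha : a ∈ calculusGraph T) (ξ : Fock n) :
    poissonAdjoint T hT b (a.1 ξ) = a.2 (poissonAdjoint T hT b ξ) := by
  have hcl : IsClosed {a : (Fock n →L[ℂ] Fock n) × (H →L[ℂ] H) |
      poissonAdjoint T hT b (a.1 ξ) = a.2 (poissonAdjoint T hT b ξ)} :=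
    isClosed_eq (by fun_prop) (by fun_prop)
  refine closure_minimal ?_ hcl ha
  rintro _ ⟨p, rfl⟩
  exact poissonAdjoint_lift hT b p ξ

theorem mem_calculusGraph (f : discAlgebra n) :
    ((f : Fock n →L[ℂ] Fock n), calculus T hT f) ∈ calculusGraph T := by
  obtain ⟨a, rfl⟩ := (AlgEquiv.ofBijective (graphFst T) (graphFst_bijective hT)).surjective f
  have h : calculus T hT (AlgEquiv.ofBijective (graphFst T) (graphFst_bijective hT) a) = a.1.2 :=
    congrArg (fun c : calculusGraph T => c.1.2)
      ((AlgEquiv.ofBijective (graphFst T) (graphFst_bijective hT)).symm_apply_apply a)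
  rw [h]
  exact a.2

theorem poissonAdjoint_disc (b : H) (f : discAlgebra n) (ξ : Fock n) :
    poissonAdjoint T hT b ((f : Fock n →L[ℂ] Fock n) ξ)
      = calculus T hT f (poissonAdjoint T hT b ξ) :=
  poissonAdjoint_of_mem_graph hT b (mem_calculusGraph hT f) ξ

/-- An operator which is intertwined with `A` by the Poisson kernel of a strict row contraction
has norm at most `‖A‖`. -/
theorem norm_le_of_intertwines {c : ℝ} (hc0 : 0 ≤ c) (hc1 : c < 1)
    (hc : ∀ h, ∑ i, ‖adjoint (T i) h‖ ^ 2 ≤ c * ‖h‖ ^ 2) {A : Fock n →L[ℂ] Fock n}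
    {B : H →L[ℂ] H} (hAB : ∀ b, poissonAdjoint T hT b ∘L A = B ∘L poissonAdjoint T hT b) :
    ‖B‖ ≤ ‖A‖ := by
  obtain ⟨S, b, -⟩ := exists_hilbertBasis ℂ H
  -- Strictness makes the full Poisson kernel isometric; its coordinates along a Hilbert basis
  -- recover the norm of h.
  have hsum : ∀ h : H, ‖h‖ₑ ^ 2 = ∑' s, ‖poissonCoord T hT (b s) h‖ₑ ^ 2 := by
    intro h
    rw [← tsum_poissonTerm_eq hT hc0 hc1 hc h]
    simp only [enorm_sq_lp, poissonCoord_apply]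
    rw [ENNReal.tsum_comm]
    refine tsum_congr fun w => ?_
    have h1 := enorm_sq_lp (b.repr (defect T (adjoint (wordOp T w) h)))
    simp only [b.repr_apply_apply] at h1
    rw [← h1, poissonTerm, LinearIsometryEquiv.enorm_map]
  have hadj : ∀ d h, adjoint A (poissonCoord T hT d h) = poissonCoord T hT d (adjoint B h) := by
    intro d h
    have := congrArg (fun D => adjoint D h) (hAB d)
    simpa only [ContinuousLinearMap.adjoint_comp, ContinuousLinearMap.comp_apply,
      adjoint_poissonAdjoint] using this
  rw [← LinearIsometryEquiv.norm_map adjoint B, ← LinearIsometryEquiv.norm_map adjoint A]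
  refine ContinuousLinearMap.opNorm_le_bound _ (norm_nonneg _) fun h => ?_
  have h1 : ‖adjoint B h‖ₑ ^ 2 ≤ (‖adjoint A‖ₑ * ‖h‖ₑ) ^ 2 := by
    rw [mul_pow, hsum, hsum h, ← ENNReal.tsum_mul_left]
    refine ENNReal.tsum_le_tsum fun s => ?_
    rw [← hadj, ← mul_pow]
    gcongr
    exact ContinuousLinearMap.le_opENorm _ _
  have h2 := (ENNReal.pow_le_pow_left_iff (by norm_num)).1 h1
  rw [← ofReal_norm, ← ofReal_norm, ← ofReal_norm, ← ENNReal.ofReal_mul (norm_nonneg _)] at h2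
  exact (ENNReal.ofReal_le_ofReal_iff (by positivity)).1 h2

end Poisson

/-! ### Elements of 𝔏_n are determined by their value at the vacuum -/

section RightCreation

variable {n : ℕ}

theorem hasSum_basisVec (ξ : Fock n) : HasSum (fun w => ξ w • basisVec w) ξ := by
  classical
  have := lp.hasSum_single (E := fun _ : FreeMonoid (Fin n) => ℂ) (p := 2) (by norm_num) ξ
  convert this using 2 with w
  rw [basisVec, ← lp.single_smul]
  simp

theorem orthonormal_basisVec_mul (w : FreeMonoid (Fin n)) :
    Orthonormal ℂ fun v => basisVec (n := n) (v * w) :=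
  orthonormal_basisVec.comp (fun v => v * w) (mul_left_injective w)

/-- The isometry `e_v ↦ e_{vw}`. -/
def rightCreation (w : FreeMonoid (Fin n)) : Fock n →L[ℂ] Fock n :=
  (isometryOf (orthonormal_basisVec_mul w)).toContinuousLinearMap

theorem rightCreation_basisVec (w v : FreeMonoid (Fin n)) :
    rightCreation w (basisVec v) = basisVec (v * w) :=
  isometryOf_basisVec (orthonormal_basisVec_mul w) v

/-- Left and right multiplication of words commute, and commuting with a fixed operator is a
WOT-closed condition. -/
theorem toeplitz_commute_rightCreation {f : Fock n →L[ℂ] Fock n} (hf : f ∈ toeplitzAlgebra n)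
    (w : FreeMonoid (Fin n)) : f * rightCreation w = rightCreation w * f := by
  have hle : ∀ p ∈ Algebra.adjoin ℂ (Set.range (creation (n := n))),
      p * rightCreation w = rightCreation w * p := by
    intro p hp
    have : p ∈ Subalgebra.centralizer ℂ {rightCreation w} := by
      refine Algebra.adjoin_le ?_ hp
      rintro _ ⟨i, rfl⟩
      rw [SetLike.mem_coe, Subalgebra.mem_centralizer_iff]
      rintro _ rfl
      refine fock_ext fun v => ?_
      simp [rightCreation_basisVec, creation_basisVec, mul_assoc]
    exact ((Subalgebra.mem_centralizer_iff ℂ).1 this _ rfl).symm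
  have hcl : IsClosed {D : Fock n →WOT[ℂ] Fock n |
      D * ContinuousLinearMapWOT.ofCLM (rightCreation w)
        = ContinuousLinearMapWOT.ofCLM (rightCreation w) * D} :=
    isClosed_eq (continuous_mul_const _) (continuous_const_mul _)
  have := closure_minimal (s := ContinuousLinearMapWOT.ofCLM ''
    (Algebra.adjoin ℂ (Set.range (creation (n := n))) : Set (Fock n →L[ℂ] Fock n))) (by
      rintro _ ⟨p, hp, rfl⟩
      exact congrArg ContinuousLinearMapWOT.ofCLM (hle p hp)) hcl ((mem_toeplitz_iff f).1 hf)
  exact (ContinuousLinearMapWOT.algEquiv (𝕜₁ := ℂ) (E := Fock n) ℂ).symm.injective this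

theorem toeplitz_apply_basisVec {f : Fock n →L[ℂ] Fock n} (hf : f ∈ toeplitzAlgebra n)
    (w : FreeMonoid (Fin n)) : f (basisVec w) = rightCreation w (f (basisVec 1)) := by
  have := congrArg (fun A : Fock n →L[ℂ] Fock n => A (basisVec 1))
    (toeplitz_commute_rightCreation hf w)
  simpa [rightCreation_basisVec] using this

theorem memℓp_radial (ξ : Fock n) {r : ℝ} (hr : r ^ 2 < 1) :
    Memℓp (fun w : FreeMonoid (Fin n) => ξ w * (r : ℂ) ^ w.length) 2 := by
  refine (memℓp_gen_iff (by norm_num)).2 ?_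
  refine (summable_norm_sq ξ).of_nonneg_of_le (fun w => by positivity) fun w => ?_
  simp only [ENNReal.toReal_ofNat, Real.rpow_ofNat, norm_mul, norm_pow, Complex.norm_real, mul_pow]
  refine mul_le_of_le_one_right (by positivity) ?_
  rw [← pow_mul, mul_comm, pow_mul, Real.norm_eq_abs, sq_abs]
  exact pow_le_one₀ (sq_nonneg r) hr.le

/-- The vector `∑ ξ_w r^{|w|} e_w`. -/
def radialVec (ξ : Fock n) (r : ℝ) : Fock n := by
  classical
  exact if hr : r ^ 2 < 1 then ⟨_, memℓp_radial ξ hr⟩ else 0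

theorem radialVec_apply (ξ : Fock n) {r : ℝ} (hr : r ^ 2 < 1) (w : FreeMonoid (Fin n)) :
    radialVec ξ r w = ξ w * (r : ℂ) ^ w.length := by
  rw [radialVec, dif_pos hr]

theorem eventually_sq_lt_one : ∀ᶠ r : ℝ in 𝓝[<] 1, r ^ 2 < 1 := by
  filter_upwards [Ioo_mem_nhdsLT (show (-1 : ℝ) < 1 by norm_num)] with r hr
  nlinarith [hr.1, hr.2]

theorem tendsto_radialVec (ξ : Fock n) : Tendsto (radialVec ξ) (𝓝[<] 1) (𝓝 ξ) := by
  rw [tendsto_iff_norm_sub_tendsto_zero]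
  have h0 : Tendsto (fun r : ℝ => ∑' w, ‖(radialVec ξ r - ξ) w‖ ^ 2) (𝓝[<] 1)
      (𝓝 (∑' _ : FreeMonoid (Fin n), 0)) := by
    -- The 4 comes from |r^k - 1| ≤ 2, squared.
    refine tendsto_tsum_of_dominated_convergence ((summable_norm_sq ξ).mul_left 4)
      (fun w => ?_) ?_
    · have hc : ContinuousAt (fun r : ℝ => ‖ξ w * (r : ℂ) ^ w.length - ξ w‖ ^ 2) 1 := by fun_prop
      have h1 : Tendsto (fun r : ℝ => ‖ξ w * (r : ℂ) ^ w.length - ξ w‖ ^ 2) (𝓝[<] 1) (𝓝 0) := by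
        simpa using hc.tendsto.mono_left nhdsWithin_le_nhds
      refine h1.congr' ?_
      filter_upwards [eventually_sq_lt_one] with r hr
      rw [lp.coeFn_sub, Pi.sub_apply, radialVec_apply ξ hr]
    · filter_upwards [eventually_sq_lt_one] with r hr w
      rw [lp.coeFn_sub, Pi.sub_apply, radialVec_apply ξ hr, Real.norm_of_nonneg (by positivity)]
      have h2 : ‖ξ w * (r : ℂ) ^ w.length - ξ w‖ ≤ 2 * ‖ξ w‖ := by
        refine (norm_sub_le _ _).trans ?_
        rw [two_mul, norm_mul, norm_pow, Complex.norm_real]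
        gcongr
        refine mul_le_of_le_one_right (norm_nonneg _) (pow_le_one₀ (norm_nonneg _) ?_)
        exact (sq_lt_one_iff_abs_lt_one r).1 hr |>.le
      calc _ ≤ (2 * ‖ξ w‖) ^ 2 := by gcongr
        _ = _ := by ring
  have h1 : ∀ η : Fock n, ‖η‖ = √(∑' w, ‖η w‖ ^ 2) := by
    intro η
    have h := lp.hasSum_norm (p := 2) (by norm_num) η
    simp only [ENNReal.toReal_ofNat, Real.rpow_ofNat] at h
    rw [h.tsum_eq, Real.sqrt_sq (norm_nonneg _)]
  simpa [h1] using h0.sqrt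

end RightCreation

/-! ### The extended calculus read off from the Poisson kernel -/

section Radial

variable {n : ℕ} {H : Type*} [NormedAddCommGroup H] [InnerProductSpace ℂ H] [CompleteSpace H]
variable {T : Fin n → H →L[ℂ] H} (hT : IsMulticontraction T)

/-- Both sides expand to ∑ f̂_v r^{|v|} T_{vw} D b. -/
theorem radialEval_poissonAdjoint (b : H) (f : Fock n →L[ℂ] Fock n) {r : ℝ} (hr : r ^ 2 < 1)
    (w : FreeMonoid (Fin n)) :
    radialEval T f r (poissonAdjoint T hT b (basisVec w))
      = poissonAdjoint T hT b (rightCreation w (radialVec (f (basisVec 1)) r)) := by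
  have h1 := ((summable_radialEval hT hr f).hasSum.mapL
    (ContinuousLinearMap.apply ℂ H (poissonAdjoint T hT b (basisVec w))))
  have h2 := ((hasSum_basisVec (radialVec (f (basisVec 1)) r)).mapL
    (poissonAdjoint T hT b ∘L rightCreation w))
  refine h1.unique (h2.congr_fun fun v => ?_)
  simp only [ContinuousLinearMap.comp_apply, map_smul, rightCreation_basisVec,
    poissonAdjoint_basisVec, wordOp_mul, radialVec_apply _ hr]
  simp [fourierCoeff]

theorem tendsto_radialEval_poissonAdjoint (b : H) {f : Fock n →L[ℂ] Fock n}
    (hf : f ∈ toeplitzAlgebra n) (w : FreeMonoid (Fin n)) :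
    Tendsto (fun r : ℝ => radialEval T f r (poissonAdjoint T hT b (basisVec w))) (𝓝[<] 1)
      (𝓝 (poissonAdjoint T hT b (f (basisVec w)))) := by
  rw [toeplitz_apply_basisVec hf w]
  have hc : Continuous fun ξ => poissonAdjoint T hT b (rightCreation w ξ) := by fun_prop
  refine ((hc.tendsto _).comp (tendsto_radialVec (f (basisVec 1)))).congr' ?_
  filter_upwards [eventually_sq_lt_one] with r hr
  exact (radialEval_poissonAdjoint hT b f hr w).symm

/-- The von Neumann inequality for the dilations of an element of `𝔏_n`. -/
theorem norm_radialEval_le (hT : IsMulticontraction T) {f : Fock n →L[ℂ] Fock n} (hf : f ∈ toeplitzAlgebra n) {r : ℝ}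
    (hr : r ^ 2 < 1) : ‖radialEval T f r‖ ≤ ‖f‖ := by
  -- Since f_r(T) is f evaluated at rT, the Poisson kernel of the strict tuple rT intertwines it
  -- with f itself.
  have hS := hT.smul hr.le
  refine norm_le_of_intertwines hS (sq_nonneg r) hr (sum_norm_adjoint_smul_sq_le hT r) fun b => ?_
  refine fock_ext fun w => ?_
  rw [ContinuousLinearMap.comp_apply, ContinuousLinearMap.comp_apply,
    toeplitz_apply_basisVec hf w]
  have h1 := ((summable_radialEval hT hr f).hasSum.mapL
    (ContinuousLinearMap.apply ℂ H (poissonAdjoint _ hS b (basisVec w))))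
  have h2 := ((hasSum_basisVec (f (basisVec 1))).mapL
    (poissonAdjoint _ hS b ∘L rightCreation w))
  refine h2.unique (h1.congr_fun fun v => ?_)
  simp only [ContinuousLinearMap.comp_apply, map_smul, rightCreation_basisVec,
    poissonAdjoint_basisVec, wordOp_mul, wordOp_smul]
  simp [fourierCoeff, smul_smul, mul_assoc, mul_comm]

/-- Along the vectors T_w D b the limit of f_r(T) is already known from the Fock space; it must
agree with the assumed limit 0. -/
theorem poissonAdjoint_comp_eq_zero {f : Fock n →L[ℂ] Fock n} (hf : f ∈ toeplitzAlgebra n)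
    (h0 : HasToeplitzValue T f 0) (b : H) : poissonAdjoint T hT b ∘L f = 0 :=
  fock_ext fun w => tendsto_nhds_unique (tendsto_radialEval_poissonAdjoint hT b hf w) (h0 _)

theorem defect_eq_zero_of_forall_inner {h : H} {w : FreeMonoid (Fin n)}
    (hw : ∀ b, inner ℂ (poissonAdjoint T hT (defect T b) (basisVec w)) h = 0) :
    defect T (adjoint (wordOp T w) h) = 0 := by
  -- With b = T_w* h the inner product is ‖D T_w* h‖².
  have := hw (adjoint (wordOp T w) h)
  rw [poissonAdjoint_basisVec, ← ContinuousLinearMap.adjoint_inner_right] at this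
  nth_rewrite 1 [← adjoint_defect T] at this
  rwa [ContinuousLinearMap.adjoint_inner_left, inner_self_eq_zero] at this

/-- The vectors T_w D² b span a dense subspace because T is c.n.c. There f_r(T) tends to 0, and the
uniform bound ‖f_r(T)‖ ≤ ‖f‖ extends this to H. Only the kernels along `defect T b` are tested,
since those are the ones that can be compared for T and Φ_X⁻¹(T). -/
theorem hasToeplitzValue_zero (hcnc : IsCNC T) {f : Fock n →L[ℂ] Fock n}
    (hf : f ∈ toeplitzAlgebra n)
    (h0 : ∀ b, poissonAdjoint T hT (defect T b) ∘L f = 0) : HasToeplitzValue T f 0 := by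
  let S : Set H := Set.range fun p : H × FreeMonoid (Fin n) =>
    poissonAdjoint T hT (defect T p.1) (basisVec p.2)
  have hdense : Dense (Submodule.span ℂ S : Set H) := by
    rw [Submodule.dense_iff_topologicalClosure_eq_top,
      Submodule.topologicalClosure_eq_top_iff, Submodule.eq_bot_iff]
    intro h hh
    refine (isCNC_iff hT).1 hcnc h fun w => defect_eq_zero_of_forall_inner hT fun b => ?_
    exact (Submodule.mem_orthogonal _ _).1 hh _ (Submodule.subset_span ⟨(b, w), rfl⟩)
  have hspan : ∀ k ∈ Submodule.span ℂ S,
      Tendsto (fun r : ℝ => radialEval T f r k) (𝓝[<] 1) (𝓝 0) := by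
    intro k hk
    induction hk using Submodule.span_induction with
    | mem k hk =>
      obtain ⟨⟨b, w⟩, rfl⟩ := hk
      have := tendsto_radialEval_poissonAdjoint hT (defect T b) hf w
      rwa [← ContinuousLinearMap.comp_apply, h0 b] at this
    | zero => simp
    | add k l _ _ hk hl => simpa using hk.add hl
    | smul c k _ hk => simpa using hk.const_smul c
  intro h
  rw [_root_.zero_apply, Metric.tendsto_nhds]
  intro ε hε
  -- Adding 1 to ‖f‖ keeps the radius meaningful when f = 0.
  obtain ⟨k, hk, hkh⟩ := Metric.dense_iff.1 hdense h (ε / (2 * (‖f‖ + 1))) (by positivity)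
  filter_upwards [eventually_sq_lt_one, Metric.tendsto_nhds.1 (hspan k hkh) (ε / 2) (by positivity)]
    with r hr hrk
  rw [dist_zero_right] at hrk ⊢
  rw [Metric.mem_ball, dist_comm, dist_eq_norm] at hk
  have h1 : ‖radialEval T f r (h - k)‖ ≤ (‖f‖ + 1) * ‖h - k‖ :=
    (ContinuousLinearMap.le_of_opNorm_le _ (norm_radialEval_le hT hf hr) _).trans
      (by gcongr; linarith)
  have h2 : (‖f‖ + 1) * ‖h - k‖ ≤ ε / 2 := by
    rw [lt_div_iff₀ (by positivity)] at hk
    linarith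
  calc ‖radialEval T f r h‖ = ‖radialEval T f r (h - k) + radialEval T f r k‖ := by
        rw [← map_add, sub_add_cancel]
    _ ≤ _ := norm_add_le _ _
    _ < ε := by linarith

end Radial

/-! ### The Möbius transform of T through the functional calculus -/

section Transform

variable {n : ℕ} {H : Type*} [NormedAddCommGroup H] [InnerProductSpace ℂ H] [CompleteSpace H]

/-- As ‖L[z]‖ < |x|, the element is already invertible in the Banach algebra 𝔩_n, so the calculus
applies to its inverse. -/
theorem inverse_denom_mem_disc (X : U1 n) :
    Ring.inverse (denom X (creation (n := n))) ∈ discAlgebra n := by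
  have hz : ∑ j, X.z j • creation j ∈ discAlgebra n :=
    sum_mem fun j _ => Subalgebra.smul_mem _ (creation_mem_disc j) _
  have hu := spectrum.mem_resolventSet_of_norm_lt_mul (𝕜 := ℂ) (A := discAlgebra n)
    (a := ⟨_, hz⟩) (k := X.x) (by
      refine lt_of_le_of_lt (mul_le_of_le_one_right (norm_nonneg _) ?_) X.norm_z_lt
      exact ContinuousLinearMap.norm_id_le)
  rw [spectrum.mem_resolventSet_iff, Algebra.algebraMap_eq_smul_one] at hu
  obtain ⟨u, hu⟩ := hu
  have h2 : denom X creation = ((u : discAlgebra n) : Fock n →L[ℂ] Fock n) := by rw [hu]; rfl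
  have h3 : denom X creation
      = (Units.map (discAlgebra n).val.toMonoidHom u : (Fock n →L[ℂ] Fock n)ˣ) := h2
  rw [h3, Ring.inverse_unit, ← map_inv]
  exact ((u⁻¹ : (discAlgebra n)ˣ) : discAlgebra n).2

/-- The element `(x - L[z])⁻¹` of `𝔩_n`. -/
def invDenomDisc (X : U1 n) : discAlgebra n := ⟨_, inverse_denom_mem_disc X⟩

theorem coe_genDisc (i : Fin n) : (genDisc i : Fock n →L[ℂ] Fock n) = creation i := rfl

theorem coe_denom_genDisc (X : U1 n) :
    ((denom X (genDisc (n := n)) : discAlgebra n) : Fock n →L[ℂ] Fock n) = denom X creation := by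
  simp [denom, coe_genDisc]

theorem denom_mul_invDenomDisc (X : U1 n) : denom X (genDisc (n := n)) * invDenomDisc X = 1 := by
  ext1
  rw [MulMemClass.coe_mul, coe_denom_genDisc]
  exact Ring.mul_inverse_cancel _ (isUnit_denom_creation X)

theorem invDenomDisc_mul_denom (X : U1 n) : invDenomDisc X * denom X (genDisc (n := n)) = 1 := by
  ext1
  rw [MulMemClass.coe_mul, coe_denom_genDisc]
  exact Ring.inverse_mul_cancel _ (isUnit_denom_creation X)

theorem autDisc_symm_genDisc (X : U1 n) (i : Fin n) :
    ((autDisc X).symm (genDisc i) : Fock n →L[ℂ] Fock n) = moebius X.inv creation i :=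
  conjU_symm_creation X i

theorem denom_mul_autDisc_symm (X : U1 n) (i : Fin n) :
    denom X.inv (genDisc (n := n)) * (autDisc X).symm (genDisc i)
      = ∑ j, X.inv.X' j i • genDisc j - X.inv.y i • 1 := by
  ext1
  rw [MulMemClass.coe_mul, coe_denom_genDisc, autDisc_symm_genDisc, denom_mul_moebius]
  simp [coe_genDisc]

theorem calculus_denom (X : U1 n) {T : Fin n → H →L[ℂ] H} (hT : IsMulticontraction T) :
    calculus T hT (denom X genDisc) = denom X T := by
  simp [denom, calculus_genDisc]

variable (X : U1 n) {T : Fin n → H →L[ℂ] H} (hT : IsMulticontraction T)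

/-- `(x - T[z])⁻¹`. -/
def invDenom : H →L[ℂ] H := calculus T hT (invDenomDisc X)

theorem denom_mul_invDenom : denom X T * invDenom X hT = 1 := by
  rw [← calculus_denom X hT, invDenom, ← map_mul, denom_mul_invDenomDisc, map_one]

theorem invDenom_mul_denom : invDenom X hT * denom X T = 1 := by
  rw [← calculus_denom X hT, invDenom, ← map_mul, invDenomDisc_mul_denom, map_one]

/-- This form, cleared of the denominator, holds in 𝓛(H) by applying ρ_T to the same identity in
𝔩_n. -/
theorem denom_mul_transformInv (i : Fin n) :
    denom X.inv T * transformInv X T hT i = ∑ j, X.inv.X' j i • T j - X.inv.y i • 1 := by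
  rw [← calculus_denom X.inv hT, transformInv, ← map_mul, denom_mul_autDisc_symm]
  simp [calculus_genDisc]

/-! ### The indefinite form and the defect of the transform -/

theorem U1.inv_mat (X : U1 n) (a b : Unit ⊕ Fin n) :
    X.inv.mat a b = signature n a a * conj (X.mat b a) * signature n b b := by
  have hs : signature n = Matrix.diagonal fun a => signature n a a := by
    ext a b
    rcases a with a | a <;> rcases b with b | b <;>
      simp [signature, Matrix.diagonal_apply, Matrix.one_apply]
  change (signature n * X.mat.conjTranspose * signature n) a b = _
  rw [hs, Matrix.mul_diagonal, Matrix.diagonal_mul]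
  simp [Matrix.diagonal_apply_eq]

/-- Entries of X⁻¹ = J X* J are conjugates of entries of X up to sign. The adjoint undoes the
conjugation, and the signs match those in the denominator. -/
theorem adjoint_denom_inv (h : H) :
    adjoint (denom X.inv T) h
      = ∑ b, X.mat (Sum.inl ()) b •
        (Sum.elim (fun _ => h) (fun j => adjoint (T j) h) : Unit ⊕ Fin n → H) b := by
  have h1 : adjoint (1 : H →L[ℂ] H) = 1 := by simp [← ContinuousLinearMap.star_eq_adjoint]
  simp [denom, h1, map_smulₛₗ, U1.x, U1.z, U1.inv_mat, signature, Fintype.sum_sum_type, map_sum]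

theorem adjoint_numerator_inv (i : Fin n) (h : H) :
    adjoint (∑ j, X.inv.X' j i • T j - X.inv.y i • (1 : H →L[ℂ] H)) h
      = ∑ b, X.mat (Sum.inr i) b •
        (Sum.elim (fun _ => h) (fun j => adjoint (T j) h) : Unit ⊕ Fin n → H) b := by
  have h1 : adjoint (1 : H →L[ℂ] H) = 1 := by simp [← ContinuousLinearMap.star_eq_adjoint]
  simp [h1, map_smulₛₗ, U1.X', U1.y, U1.inv_mat, signature, Fintype.sum_sum_type, map_sum, add_comm]

theorem adjoint_transformInv (i : Fin n) (h : H) :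
    adjoint (transformInv X T hT i) (adjoint (denom X.inv T) h)
      = ∑ b, X.mat (Sum.inr i) b •
        (Sum.elim (fun _ => h) (fun j => adjoint (T j) h) : Unit ⊕ Fin n → H) b := by
  rw [← adjoint_numerator_inv, ← denom_mul_transformInv X hT,
    ← ContinuousLinearMap.star_eq_adjoint, ← ContinuousLinearMap.star_eq_adjoint,
    ← ContinuousLinearMap.star_eq_adjoint, star_mul]
  rfl

/-- This is invariance of J under X, applied to the columns (h, T_j* h) and (k, T_j* k). -/
theorem inner_transformInv (h k : H) :
    inner ℂ (adjoint (denom X.inv T) h) (adjoint (denom X.inv T) k)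
        - ∑ i, inner ℂ (adjoint (transformInv X T hT i) (adjoint (denom X.inv T) h))
          (adjoint (transformInv X T hT i) (adjoint (denom X.inv T) k))
      = inner ℂ h k - ∑ i, inner ℂ (adjoint (T i) h) (adjoint (T i) k) := by
  have := X.inner_invariant
    (Sum.elim (fun _ => h) (fun j => adjoint (T j) h) : Unit ⊕ Fin n → H)
    (Sum.elim (fun _ => k) (fun j => adjoint (T j) k) : Unit ⊕ Fin n → H)
  simp only [← adjoint_denom_inv, ← adjoint_transformInv X hT, Sum.elim_inl, Sum.elim_inr] at this
  linear_combination -this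

theorem adjoint_denom_invDenom (h : H) :
    adjoint (denom X T) (adjoint (invDenom X hT) h) = h := by
  have := congrArg (fun A => adjoint A h) (invDenom_mul_denom X hT)
  simpa [← ContinuousLinearMap.star_eq_adjoint] using this

theorem adjoint_invDenom_denom (h : H) :
    adjoint (invDenom X hT) (adjoint (denom X T) h) = h := by
  have := congrArg (fun A => adjoint A h) (denom_mul_invDenom X hT)
  simpa [← ContinuousLinearMap.star_eq_adjoint] using this

theorem isMulticontraction_transformInv : IsMulticontraction (transformInv X T hT) := by
  refine isMulticontraction_iff.2 fun h => ?_
  -- The adjoint of the denominator is invertible, so every vector has the form required by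
  -- `inner_transformInv`.
  have e := inner_transformInv X hT (adjoint (invDenom X.inv hT) h) (adjoint (invDenom X.inv hT) h)
  rw [adjoint_denom_invDenom] at e
  simp only [inner_self_eq_norm_sq_to_K] at e
  have e2 : ‖h‖ ^ 2 - ∑ i, ‖adjoint (transformInv X T hT i) h‖ ^ 2
      = ‖adjoint (invDenom X.inv hT) h‖ ^ 2
        - ∑ i, ‖adjoint (T i) (adjoint (invDenom X.inv hT) h)‖ ^ 2 := by
    apply Complex.ofReal_injective
    push_cast
    exact e
  linarith [sum_norm_adjoint_sq_le hT (adjoint (invDenom X.inv hT) h)]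

/-- Polarised, the invariance reads D_S² = M D_T² M* with M = `invDenom X.inv hT`. The identity
concerns the squares and does not give such a formula for the roots. -/
theorem defect_sq_transformInv (b : H) :
    defect (transformInv X T hT) (defect (transformInv X T hT) b)
      = invDenom X.inv hT (defect T (defect T (adjoint (invDenom X.inv hT) b))) := by
  have hS := isMulticontraction_transformInv X hT
  have key : ∀ {R : Fin n → H →L[ℂ] H} (hR : IsMulticontraction R) (h k : H),
      inner ℂ h (defect R (defect R k))
        = inner ℂ h k - ∑ i, inner ℂ (adjoint (R i) h) (adjoint (R i) k) := by
    intro R hR h k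
    have := congrArg (fun A => inner ℂ h (A k)) (defect_mul_self hR)
    simpa [inner_sub_right, inner_sum, ContinuousLinearMap.adjoint_inner_left] using this
  refine ext_inner_left ℂ fun h => ?_
  rw [key hS, ← ContinuousLinearMap.adjoint_inner_left, key hT, ← inner_transformInv X hT,
    adjoint_denom_invDenom, adjoint_denom_invDenom]

/-! ### The Poisson kernel of the transform -/

theorem wordOp_transformInv (w : FreeMonoid (Fin n)) :
    wordOp (transformInv X T hT) w
      = calculus T hT (FreeMonoid.lift (fun i => (autDisc X).symm (genDisc i)) w) := by
  induction w using FreeMonoid.inductionOn' with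
  | one => simp [wordOp_one]
  | of_mul i w ih => rw [wordOp_of_mul, ih, map_mul, map_mul, FreeMonoid.lift_eval_of]; rfl

/-- On basis vectors U_X* is given by the formula defining the unitary of X⁻¹, because U_X
intertwines Φ_X⁻¹(L_i) with L_i. -/
theorem unitaryU_symm_basisVec (w : FreeMonoid (Fin n)) :
    (unitaryU X).symm (basisVec w)
      = ((FreeMonoid.lift (fun i => (autDisc X).symm (genDisc i)) w : discAlgebra n) :
          Fock n →L[ℂ] Fock n) ((invDenomDisc X.inv : Fock n →L[ℂ] Fock n) (basisVec 1)) := by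
  rw [LinearIsometryEquiv.symm_apply_eq]
  induction w using FreeMonoid.inductionOn' with
  | one =>
    have h := congrArg (fun A : Fock n →L[ℂ] Fock n => A (basisVec 1)) (denom_comp_isometryU X)
    have h1 : isometryU X (basisVec 1) = vacuumImage X := by
      rw [isometryU_basisVec]; simp [unitaryVec]
    simp only [mul_apply_eq_comp, LinearIsometry.coe_toContinuousLinearMap, h1,
      denom_vacuumImage] at h
    rw [map_one]
    exact h
  | of_mul i w ih =>
    rw [map_mul, FreeMonoid.lift_eval_of, MulMemClass.coe_mul, autDisc_symm_genDisc,
      mul_apply_eq_comp, ← creation_basisVec, ih]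
    exact congrArg (fun A : Fock n →L[ℂ] Fock n => A _) (creation_mul_isometryU X i)

/-- The Poisson kernel of `Φ_X⁻¹(T)` is the one of `T` composed with `U_X`. -/
theorem poissonAdjoint_transformInv (b : H) (ξ : Fock n) :
    poissonAdjoint (transformInv X T hT) (isMulticontraction_transformInv X hT)
        (defect (transformInv X T hT) b) ξ
      = poissonAdjoint T hT (defect T (adjoint (invDenom X.inv hT) b)) ((unitaryU X).symm ξ) := by
  have : poissonAdjoint (transformInv X T hT) (isMulticontraction_transformInv X hT)
        (defect (transformInv X T hT) b)
      = poissonAdjoint T hT (defect T (adjoint (invDenom X.inv hT) b))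
        ∘L ((unitaryU X).symm : Fock n →L[ℂ] Fock n) := by
    refine fock_ext fun w => ?_
    have h2 : ((unitaryU X).symm : Fock n →L[ℂ] Fock n) (basisVec w)
        = (unitaryU X).symm (basisVec w) := rfl
    -- S_w D_S² b becomes ρ_T(Φ_X⁻¹(L_w)) M D_T² M* b; intertwining is used twice, for Φ_X⁻¹(L_w)
    -- and for M.
    rw [poissonAdjoint_basisVec, defect_sq_transformInv, wordOp_transformInv,
      ContinuousLinearMap.comp_apply, h2, unitaryU_symm_basisVec, poissonAdjoint_disc,
      poissonAdjoint_disc, poissonAdjoint_basisVec, wordOp_one]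
    rfl
  exact congrArg (fun A : Fock n →L[ℂ] H => A ξ) this

theorem isCNC_transformInv (hcnc : IsCNC T) : IsCNC (transformInv X T hT) := by
  have hS := isMulticontraction_transformInv X hT
  refine (isCNC_iff hS).2 fun h hh => (isCNC_iff hT).1 hcnc h fun w => ?_
  refine defect_eq_zero_of_forall_inner hT fun b => ?_
  have h0 : adjoint (poissonAdjoint _ hS
      (defect (transformInv X T hT) (adjoint (denom X.inv T) b))) h = 0 := by
    rw [adjoint_poissonAdjoint]
    ext v
    simp [poissonCoord_apply, hh]
  -- The arguments are chosen so that M* and U_X* cancel, leaving the kernel of T along D_T b at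
  -- e_w.
  have := poissonAdjoint_transformInv X hT (adjoint (denom X.inv T) b) (unitaryU X (basisVec w))
  rw [LinearIsometryEquiv.symm_apply_apply, adjoint_invDenom_denom] at this
  rw [← this, ← ContinuousLinearMap.adjoint_inner_right, h0, inner_zero_right]

/-! ### Transport of the calculus and of closed ideals -/

theorem continuous_autDisc_symm : Continuous (autDisc X).symm :=
  Continuous.subtype_mk
    ((unitaryU X).toContinuousLinearEquiv.conjContinuousAlgEquiv.symm.continuous.comp
      continuous_subtype_val) _

/-- The homomorphism ρ_T ∘ Φ_X⁻¹ is continuous and sends L_i to S_i, so it is the calculus of S by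
uniqueness. -/
theorem calculus_transformInv (f : discAlgebra n) :
    calculus (transformInv X T hT) (isMulticontraction_transformInv X hT) f
      = calculus T hT ((autDisc X).symm f) := by
  have hc : Continuous (calculus T hT) :=
    AddMonoidHomClass.continuous_of_bound (calculus T hT) 1
      fun f => by rw [one_mul]; exact norm_calculus_le T hT f
  have := calculus_unique _ (isMulticontraction_transformInv X hT)
    ((calculus T hT).comp (autDisc X).symm.toAlgHom) (hc.comp (continuous_autDisc_symm X))
    fun i => rfl
  exact (congrArg (fun σ => σ f) this).symm

theorem isClosed_mapDisc {j : TwoSidedIdeal (discAlgebra n)}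
    (hj : IsClosed (j : Set (discAlgebra n))) :
    IsClosed (mapDisc X j : Set (discAlgebra n)) := by
  rw [coe_mapDisc]
  have : autDisc X '' (j : Set (discAlgebra n)) = (autDisc X).symm ⁻¹' j :=
    (autDisc X).toEquiv.image_eq_preimage_symm _
  rw [this]
  exact hj.preimage (continuous_autDisc_symm X)

theorem isWOTClosed_mapToeplitz {J : TwoSidedIdeal (toeplitzAlgebra n)} (hJ : IsWOTClosed J) :
    IsWOTClosed (mapToeplitz X J) := by
  have hc : Continuous fun D : Fock n →WOT[ℂ] Fock n =>
      ContinuousLinearMapWOT.ofCLM ((unitaryU X).symm : Fock n →L[ℂ] Fock n) * D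
        * ContinuousLinearMapWOT.ofCLM (unitaryU X : Fock n →L[ℂ] Fock n) :=
    (continuous_mul_const _).comp (continuous_const_mul _)
  rw [IsWOTClosed, coe_mapToeplitz]
  -- The image of the ideal is its preimage under D ↦ U_X* D U_X, which is WOT-continuous because
  -- multiplication is separately continuous.
  convert hJ.preimage hc using 1
  ext D
  constructor
  · rintro ⟨_, ⟨f, hf, rfl⟩, rfl⟩
    refine ⟨f, hf, congrArg ContinuousLinearMapWOT.ofCLM ?_⟩
    exact ((conjU X).symm_apply_apply (f : Fock n →L[ℂ] Fock n)).symm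
  · rintro ⟨f, hf, hfD⟩
    refine ⟨_, ⟨f, hf, rfl⟩, ?_⟩
    obtain ⟨A, rfl⟩ :=
      (ContinuousLinearMapWOT.algEquiv (𝕜₁ := ℂ) (E := Fock n) ℂ).symm.surjective D
    have hfA : (f : Fock n →L[ℂ] Fock n) = (conjU X).symm A :=
      (ContinuousLinearMapWOT.algEquiv (𝕜₁ := ℂ) (E := Fock n) ℂ).symm.injective hfD
    refine congrArg ContinuousLinearMapWOT.ofCLM ?_
    change conjU X (f : Fock n →L[ℂ] Fock n) = A
    rw [hfA]
    exact (conjU X).apply_symm_apply A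

end Transform

end RowContraction

end

theorem proposition6p1 {n : ℕ} (hn : 0 < n)
    {H : Type*} [NormedAddCommGroup H] [InnerProductSpace ℂ H] [CompleteSpace H]
    (X : U1 n) (T : Fin n → H →L[ℂ] H) (hT : IsMulticontraction T) :
    (∀ j : TwoSidedIdeal (discAlgebra n), IsClosed (j : Set (discAlgebra n)) →
      IsDiscConstrained T j →
        IsClosed (mapDisc X j : Set (discAlgebra n)) ∧
        IsDiscConstrained (transformInv X T hT) (mapDisc X j)) ∧
    (IsCNC T → ∀ J : TwoSidedIdeal (toeplitzAlgebra n), IsWOTClosed J →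
      IsToeplitzConstrained T J →
        IsWOTClosed (mapToeplitz X J) ∧
        IsToeplitzConstrained (transformInv X T hT) (mapToeplitz X J)) := by
  have hS := isMulticontraction_transformInv X hT
  refine ⟨fun j hj hjT => ⟨isClosed_mapDisc X hj, hS, fun g hg => ?_⟩,
    fun hcnc J hJ hJT => ⟨isWOTClosed_mapToeplitz X hJ, hS, isCNC_transformInv X hT hcnc,
      fun g hg => ?_⟩⟩
  · rw [← SetLike.mem_coe, coe_mapDisc] at hg
    obtain ⟨f, hf, rfl⟩ := hg
    rw [calculus_transformInv, AlgEquiv.symm_apply_apply]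
    exact hjT.2 f hf
  · rw [← SetLike.mem_coe, coe_mapToeplitz] at hg
    obtain ⟨f, hf, rfl⟩ := hg
    -- It remains to check that the Poisson kernel of S annihilates the range of Φ_X(f); passing to
    -- T replaces Φ_X(f) by f.
    refine hasToeplitzValue_zero hS (isCNC_transformInv X hT hcnc) (autToeplitz X f).2 fun b => ?_
    ext ξ
    rw [ContinuousLinearMap.comp_apply, poissonAdjoint_transformInv]
    have h1 : (unitaryU X).symm ((autToeplitz X f : Fock n →L[ℂ] Fock n) ξ)
        = (f : Fock n →L[ℂ] Fock n) ((unitaryU X).symm ξ) :=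
      (unitaryU X).symm_apply_apply _
    rw [h1, ← ContinuousLinearMap.comp_apply, poissonAdjoint_comp_eq_zero hT f.2 (hJT.2.2 f hf)]
    simp
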